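/- **Setting.** A school matching instance $I=(A,B,\succ,q)$ consists of finite sets $A$ of students and $B$ of schools (here called classes), for every $a\in A$ a strict total order $\succ_a$ on $B\cup\{\emptyset\}$, for every $b\in B$ a strict total order $\succ_b$ on $A\cup\{\emptyset\}$ (where $\emptyset$ is the outside option), and quotas $q_b\le |A|$. A matching $M$ assigns to every student $a$ a partner $M(a)\in B\cup\{\emptyset\}$ so that every class $b$ receives at most $q_b$ students; $M(b)$ is the set of students assigned to $b$, together with $\emptyset$ if there are fewer than $q_b$ of them. $M$ is stable if there is no pair $ab\in A\times B$ with $b\succ_a M(a)$ and $a\succ_b a'$ for some $a'\in M(b)$, no student $a$ with $\emptyset\succ_a M(a)$, and no class $b$ with $\emptyset\succ_b a$ for some student $a\in M(b)$. A student $a$ is eligible for a class $b$ if $b\succ_a\emptyset$. An instance of (MSSP) consists of a school matching instance $(A,B,\succ,q)$, a set $\mathcal C\subseteq A\times A$ of pairs of distinct students (siblings), and a partition of $B$ into nonempty parts (activities), such that 1. every student is eligible for at most one class of each activity; 2. siblings rank activities in the same order: if $(a,\bar a)\in\mathcal C$, $c,c'$ are activities, $a$ is eligible for $b\in c$ and $b'\in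 c'$, and $\bar a$ is eligible for $\bar b\in c$ and $\bar b'\in c'$, then $b\succ_a b'$ if and only if $\bar b\succ_{\bar a}\bar b'$. The question is whether there exists an activity-stable matching, that is, a stable matching $M$ such that for every $(a,\bar a)\in\mathcal C$ both $M(a)$ and $M(\bar a)$ are classes and belong to the same activity. **Theorem.** (MSSP) can be solved in polynomial time: there are an algorithm and a polynomial $p$ such that on every instance of (MSSP), given explicitly by its preference rankings, quotas, activities and sibling pairs in an encoding of $N$ bits, the algorithm halts after at most $p(N)$ steps and answers correctly whether an activity-stable matching exists. -/

import Mathlib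

/-! ### A random access machine with a step count

Programs of a small imperative language over finitely many unbounded arrays of natural numbers
(a scalar variable is an array of which only the cell `0` is used). Every operation costs one step.
The only arithmetic is addition and truncated subtraction, so each step lengthens the binary
representation of the largest number in use by at most one bit (beyond the constants of the
program); hence polynomial time on this machine is the same as polynomial time on a Turing
machine. -/

namespace RAM

/-- The contents of the memory: `s x i` is the value of cell `i` of the array with name `x`. -/
abbrev Store := ℕ → ℕ → ℕ

/-- Arithmetic expressions. The names of arrays are constants of the program, the index of a cell
is computed. -/
inductive Expr : Type
  | num (n : ℕ)
  | read (x : ℕ) (i : Expr)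
  | add (e f : Expr)
  | sub (e f : Expr)

/-- The value of an expression. -/
def Expr.value (s : Store) : Expr → ℕ
  | .num n => n
  | .read x i => s x (i.value s)
  | .add e f => e.value s + f.value s
  | .sub e f => e.value s - f.value s

/-- The number of steps taken to evaluate an expression: one for each operation in it. -/
def Expr.cost : Expr → ℕ
  | .num _ => 1
  | .read _ i => i.cost + 1
  | .add e f => e.cost + f.cost + 1
  | .sub e f => e.cost + f.cost + 1

/-- Programs. A test succeeds when the value of the expression is not `0`. -/
inductive Program : Type
  | skip
  | write (x : ℕ) (i e : Expr)
  | seq (c d : Program)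
  | cond (e : Expr) (c d : Program)
  | loop (e : Expr) (c : Program)

/-- `Exec c s t s'`: started in the store `s`, the program `c` halts after exactly `t` steps in
the store `s'`. -/
inductive Exec : Program → Store → ℕ → Store → Prop
  | skip (s : Store) : Exec .skip s 1 s
  | write (s : Store) (x : ℕ) (i e : Expr) :
      Exec (.write x i e) s (i.cost + e.cost + 1)
        (Function.update s x (Function.update (s x) (i.value s) (e.value s)))
  | seq {c d : Program} {s s' s'' : Store} {t t' : ℕ} :
      Exec c s t s' → Exec d s' t' s'' → Exec (.seq c d) s (t + t') s''
  | condTrue {e : Expr} {c d : Program} {s s' : Store} {t : ℕ} :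
      e.value s ≠ 0 → Exec c s t s' → Exec (.cond e c d) s (e.cost + 1 + t) s'
  | condFalse {e : Expr} {c d : Program} {s s' : Store} {t : ℕ} :
      e.value s = 0 → Exec d s t s' → Exec (.cond e c d) s (e.cost + 1 + t) s'
  | loopTrue {e : Expr} {c : Program} {s s' s'' : Store} {t t' : ℕ} :
      e.value s ≠ 0 → Exec c s t s' → Exec (.loop e c) s' t' s'' →
        Exec (.loop e c) s (e.cost + 1 + t + t') s''
  | loopFalse {e : Expr} {c : Program} {s : Store} :
      e.value s = 0 → Exec (.loop e c) s (e.cost + 1) s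

/-- The initial store on the input `w`: array `0` holds `w`, cell `0` of array `1` holds the number
of entries of `w`, and everything else is `0`. -/
def input (w : List ℕ) : Store := fun x i =>
  if x = 0 then w.getD i 0 else if x = 1 ∧ i = 0 then w.length else 0

/-- The answer of the machine, read from cell `0` of array `2`. -/
def output (s : Store) : ℕ := s 2 0

/-- The number of bits needed to write down `w`, one separator included for each entry. -/
def bitSize (w : List ℕ) : ℕ := (w.map fun n => n.size + 1).sum

/-- The decision problem with instances `x : α`, presented to the machine as `enc x`, and question
`P x`, can be solved in polynomial time: a single program halts on every instance after a number of
steps that is at most a fixed polynomial of the length of the input, with output `1` if the answer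
is yes and with output `0` if it is no. -/
def SolvableInPolyTime {α : Type} (enc : α → List ℕ) (P : α → Prop) : Prop :=
  ∃ (c : Program) (p : Polynomial ℕ), ∀ x : α, ∃ (t : ℕ) (s : Store),
    Exec c (input (enc x)) t s ∧ t ≤ p.eval (bitSize (enc x)) ∧
      (P x → output s = 1) ∧ (¬ P x → output s = 0)

end RAM

/-! ### Stable matchings with quotas -/

/-- A school matching instance with students `Fin nA`, schools `Fin nB` and the outside option
`none`. The strict order of an agent over the `n` options it has is given by the bijection that
sends an option to its rank in `{0, …, n - 1}`, where `0` is the rank of the favourite. -/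
structure SchoolInstance where
  nA : ℕ
  nB : ℕ
  studentRank : Fin nA → Option (Fin nB) ≃ Fin (nB + 1)
  schoolRank : Fin nB → Option (Fin nA) ≃ Fin (nA + 1)
  quota : Fin nB → ℕ
  quota_le : ∀ b, quota b ≤ nA

namespace SchoolInstance

variable (I : SchoolInstance)

/-- Student `a` strictly prefers `x` to `y`. -/
def StudentPrefers (a : Fin I.nA) (x y : Option (Fin I.nB)) : Prop :=
  I.studentRank a x < I.studentRank a y

/-- School `b` strictly prefers `x` to `y`. -/
def SchoolPrefers (b : Fin I.nB) (x y : Option (Fin I.nA)) : Prop :=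
  I.schoolRank b x < I.schoolRank b y

/-- The students that are assigned to the school `b`. -/
def assigned (M : Fin I.nA → Option (Fin I.nB)) (b : Fin I.nB) : Finset (Fin I.nA) :=
  Finset.univ.filter fun a => M a = some b

/-- A matching is given by the partner of every student, a school or the outside option, where no
school exceeds its quota. -/
def IsMatching (M : Fin I.nA → Option (Fin I.nB)) : Prop :=
  ∀ b, (I.assigned M b).card ≤ I.quota b

/-- The partners of the school `b`: the students assigned to it and, if it has a free seat, the
outside option. -/
def partners (M : Fin I.nA → Option (Fin I.nB)) (b : Fin I.nB) : Set (Option (Fin I.nA)) :=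
  {x | (∃ a ∈ I.assigned M b, x = some a) ∨ (x = none ∧ (I.assigned M b).card < I.quota b)}

/-- `ab` is a blocking pair. -/
def BlockingPair (M : Fin I.nA → Option (Fin I.nB)) (a : Fin I.nA) (b : Fin I.nB) : Prop :=
  I.StudentPrefers a (some b) (M a) ∧ ∃ x ∈ I.partners M b, I.SchoolPrefers b (some a) x

/-- The student `a` is a blocking agent. -/
def BlockingStudent (M : Fin I.nA → Option (Fin I.nB)) (a : Fin I.nA) : Prop :=
  I.StudentPrefers a none (M a)

/-- The school `b` is a blocking agent. -/
def BlockingSchool (M : Fin I.nA → Option (Fin I.nB)) (b : Fin I.nB) : Prop :=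
  ∃ a ∈ I.assigned M b, I.SchoolPrefers b none (some a)

/-- Stable matchings. -/
def IsStable (M : Fin I.nA → Option (Fin I.nB)) : Prop :=
  I.IsMatching M ∧ (∀ a b, ¬ I.BlockingPair M a b) ∧ (∀ a, ¬ I.BlockingStudent M a) ∧
    ∀ b, ¬ I.BlockingSchool M b

/-- The student `a` is eligible for the class `b`: it prefers `b` to the outside option. -/
def Eligible (a : Fin I.nA) (b : Fin I.nB) : Prop :=
  I.StudentPrefers a (some b) none

end SchoolInstance

/-! ### Matching siblings to the same activity -/

/-- An instance of (MSSP). The schools are called classes; they are partitioned into `k` nonempty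
activities, each student is eligible for at most one class of each activity, and siblings rank the
activities in the same order. -/
structure MSSPInstance extends SchoolInstance where
  siblings : Finset (Fin nA × Fin nA)
  siblings_ne : ∀ p ∈ siblings, p.1 ≠ p.2
  k : ℕ
  activity : Fin nB → Fin k
  activity_surjective : Function.Surjective activity
  eligible_unique : ∀ a b b', toSchoolInstance.Eligible a b → toSchoolInstance.Eligible a b' →
    activity b = activity b' → b = b'
  same_order : ∀ p ∈ siblings, ∀ b₁ b₂ b₁' b₂' : Fin nB,
    toSchoolInstance.Eligible p.1 b₁ → toSchoolInstance.Eligible p.1 b₂ →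
    toSchoolInstance.Eligible p.2 b₁' → toSchoolInstance.Eligible p.2 b₂' →
    activity b₁ = activity b₁' → activity b₂ = activity b₂' →
      (toSchoolInstance.StudentPrefers p.1 (some b₁) (some b₂) ↔
        toSchoolInstance.StudentPrefers p.2 (some b₁') (some b₂'))

namespace MSSPInstance

variable (I : MSSPInstance)

/-- `M` is an activity-stable matching: it is stable, and both members of each pair of siblings are
assigned to classes, of the same activity. -/
def IsActivityStable (M : Fin I.nA → Option (Fin I.nB)) : Prop :=
  I.IsStable M ∧ ∀ p ∈ I.siblings, ∃ b b' : Fin I.nB,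
    M p.1 = some b ∧ M p.2 = some b' ∧ I.activity b = I.activity b'

/-- The instance as a sequence of numbers: the numbers of students, classes and activities, the
ranks given by each student to the outside option and to the classes, the ranks given by each class
to the outside option and to the students, the quotas, the activities of the classes, and the
incidence matrix of the set of pairs of siblings. -/
def encode : List ℕ :=
  [I.nA, I.nB, I.k]
    ++ (List.finRange I.nA).flatMap (fun a =>
        (none :: (List.finRange I.nB).map some).map fun x => (I.studentRank a x : ℕ))
    ++ (List.finRange I.nB).flatMap (fun b =>
        (none :: (List.finRange I.nA).map some).map fun x => (I.schoolRank b x : ℕ))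
    ++ (List.finRange I.nB).map I.quota
    ++ (List.finRange I.nB).map (fun b => (I.activity b : ℕ))
    ++ (List.finRange I.nA).flatMap (fun a =>
        (List.finRange I.nA).map fun a' => if (a, a') ∈ I.siblings then 1 else 0)

end MSSPInstance

/-!
Let every student start at her favourite option and walk down her list, moving on from a class
whenever no activity-stable matching below the current assignment can leave her there: she is
unacceptable to the class, its quota is filled by better students that are assigned to it, a better
student has already passed it, or a sibling has passed all her classes of the same activity. By
induction, each student always likes the current assignment at least as much as any given
activity-stable matching.

After at most one move for each pair of a student and a class no move is left. If there is an
activity-stable matching, counting the students in each class as in the rural hospitals theorem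
shows that the final assignment fills the same classes to the same extent and leaves the same
students unassigned. Hence every class passed by a student acceptable to it is full and all siblings
are assigned. Conversely, these two conditions make the final assignment stable, and activity-stable
as well: if siblings ended in different activities, each would still have a class of the activity of
the other at or below her own class, which contradicts the common order of the activities.

All the conditions involved are first-order formulas in which quantifiers range over the students
and the classes and may count, so that they can be evaluated by nested loops in polynomial time.
-/

/-! ### Programs that run in polynomial time -/

namespace RAM

/-- The store `s` after the value `n` has been written to the cell `i` of the array `x`. -/
def Store.put (s : Store) (x i n : ℕ) : Store :=
  Function.update s x (Function.update (s x) i n)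

theorem Store.put_of_ne (s : Store) {x y : ℕ} (h : y ≠ x) (i n : ℕ) : s.put x i n y = s y :=
  Function.update_of_ne h ..

theorem Store.put_apply_self (s : Store) (x i n : ℕ) :
    s.put x i n x = Function.update (s x) i n :=
  Function.update_self ..

theorem Store.put_eq_self (s : Store) (x i : ℕ) : s.put x i (s x i) = s := by
  rw [Store.put, Function.update_eq_self, Function.update_eq_self]

theorem Store.eqOn_put (s : Store) {D x : ℕ} (h : D ≤ x) (i n : ℕ) :
    Set.EqOn s (s.put x i n) (Set.Iio D) :=
  fun _ hy => (s.put_of_ne (by have := Set.mem_Iio.1 hy; omega) i n).symm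

/-- The measure of the input in terms of which running times are bounded: the length and the first
two entries. The entries bound the loops over the students and over the classes. -/
def inputSize (s : Store) : ℕ := max (s 1 0) (max (s 0 0) (s 0 1))

theorem inputSize_congr {s s' : Store} (h : Set.EqOn s s' (Set.Iio 2)) :
    inputSize s = inputSize s' := by
  have h0 : s 0 = s' 0 := h (by simp)
  have h1 : s 1 = s' 1 := h (by simp)
  rw [inputSize, inputSize, h0, h1]

/-- `c.Implements R`: the program `c` halts in time polynomial in the size of the input, does not
touch the arrays `0` and `1`, which hold the input, and relates the initial to the final store by
`R`. -/
def Program.Implements (c : Program) (R : Store → Store → Prop) : Prop :=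
  ∃ T : Polynomial ℕ, ∀ s, ∃ t s', Exec c s t s' ∧ t ≤ T.eval (inputSize s) ∧
    Set.EqOn s s' (Set.Iio 2) ∧ R s s'

namespace Program.Implements

variable {c d : Program} {R R' : Store → Store → Prop}

theorem mono (hc : c.Implements R) (h : ∀ s s', R s s' → R' s s') : c.Implements R' := by
  obtain ⟨T, hT⟩ := hc
  refine ⟨T, fun s => ?_⟩
  obtain ⟨t, s', hrun, ht, hs, hR⟩ := hT s
  exact ⟨t, s', hrun, ht, hs, h s s' hR⟩

theorem skip : Program.skip.Implements fun s s' => s' = s :=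
  ⟨1, fun s => ⟨1, s, .skip s, by simp, Set.eqOn_refl _ _, rfl⟩⟩

theorem write {x : ℕ} (hx : 2 ≤ x) (i e : Expr) :
    (Program.write x i e).Implements fun s s' => s' = s.put x (i.value s) (e.value s) :=
  ⟨Polynomial.C (i.cost + e.cost + 1), fun s =>
    ⟨_, _, .write s x i e, by simp, s.eqOn_put hx _ _, rfl⟩⟩

theorem seq (hc : c.Implements R) (hd : d.Implements R') :
    (Program.seq c d).Implements fun s s'' => ∃ s', R s s' ∧ R' s' s'' := by
  obtain ⟨T, hT⟩ := hc
  obtain ⟨T', hT'⟩ := hd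
  refine ⟨T + T', fun s => ?_⟩
  obtain ⟨t, s', hrun, ht, hs, hR⟩ := hT s
  obtain ⟨t', s'', hrun', ht', hs', hR'⟩ := hT' s'
  refine ⟨t + t', s'', .seq hrun hrun', ?_, hs.trans hs', s', hR, hR'⟩
  rw [← inputSize_congr hs] at ht'
  rw [Polynomial.eval_add]
  exact add_le_add ht ht'

theorem cond (e : Expr) (hc : c.Implements R) (hd : d.Implements R') :
    (Program.cond e c d).Implements fun s s' =>
      (e.value s ≠ 0 → R s s') ∧ (e.value s = 0 → R' s s') := by
  obtain ⟨T, hT⟩ := hc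
  obtain ⟨T', hT'⟩ := hd
  refine ⟨Polynomial.C (e.cost + 1) + (T + T'), fun s => ?_⟩
  simp only [Polynomial.eval_add, Polynomial.eval_C]
  by_cases he : e.value s = 0
  · obtain ⟨t, s', hrun, ht, hs, hR⟩ := hT' s
    exact ⟨_, s', .condFalse he hrun, by omega, hs, fun h => absurd he h, fun _ => hR⟩
  · obtain ⟨t, s', hrun, ht, hs, hR⟩ := hT s
    exact ⟨_, s', .condTrue he hrun, by omega, hs, fun _ => hR, fun h => absurd h he⟩

end Program.Implements

theorem exists_exec_loop {e : Expr} {c : Program} {B : ℕ} {Inv : ℕ → Store → Prop}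
    (hexit : ∀ s, Inv 0 s → e.value s = 0)
    (hbody : ∀ m s, Inv (m + 1) s →
      e.value s ≠ 0 ∧ ∃ t s', Exec c s t s' ∧ t ≤ B ∧ Inv m s') (m : ℕ) :
    ∀ s, Inv m s → ∃ t s', Exec (.loop e c) s t s' ∧ t ≤ (m + 1) * (e.cost + 1 + B) ∧ Inv 0 s' := by
  induction m with
  | zero => exact fun s hs => ⟨_, s, .loopFalse (hexit s hs), by omega, hs⟩
  | succ m ih =>
    intro s hs
    obtain ⟨he, t, s', hrun, ht, hs'⟩ := hbody m s hs
    obtain ⟨t', s'', hrun', ht', hs''⟩ := ih s' hs'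
    refine ⟨_, s'', .loopTrue he hrun hrun', ?_, hs''⟩
    calc e.cost + 1 + t + t'
        ≤ e.cost + 1 + B + (m + 1) * (e.cost + 1 + B) := by gcongr
      _ = (m + 1 + 1) * (e.cost + 1 + B) := by ring

/-- The entry of the input at position `i`. -/
def Expr.entry (i : ℕ) : Expr := .read 0 (.num i)

/-- The number of entries of the input. -/
def Expr.inputLength : Expr := .read 1 (.num 0)

/-- The numbers of iterations that a loop of a polynomial time program can have. -/
inductive Expr.IsLoopBound : Expr → Prop
  | inputLength : IsLoopBound .inputLength
  | entry_zero : IsLoopBound (.entry 0)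
  | entry_one : IsLoopBound (.entry 1)

theorem Expr.IsLoopBound.value_le_inputSize {b : Expr} (hb : b.IsLoopBound) (s : Store) :
    b.value s ≤ inputSize s := by
  cases hb <;> simp [Expr.value, Expr.entry, Expr.inputLength, inputSize]

theorem Expr.IsLoopBound.value_congr {b : Expr} (hb : b.IsLoopBound) {s s' : Store}
    (h : Set.EqOn s s' (Set.Iio 2)) : b.value s = b.value s' := by
  have h0 : s 0 = s' 0 := h (by simp)
  have h1 : s 1 = s' 1 := h (by simp)
  cases hb <;> simp [Expr.value, Expr.entry, Expr.inputLength, h0, h1]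

/-- The program `for v = 0, …, b - 1 do c`. -/
def Program.forLoop (v : ℕ) (b : Expr) (c : Program) : Program :=
  .seq (.write v (.num 0) (.num 0))
    (.loop (.sub b (.read v (.num 0)))
      (.seq c (.write v (.num 0) (.add (.read v (.num 0)) (.num 1)))))

theorem Program.Implements.forLoop {v : ℕ} {b : Expr} {c : Program} {R : Store → Store → Prop}
    {Inv : Store → ℕ → Store → Prop} (hc : c.Implements R) (hb : b.IsLoopBound) (hv : 2 ≤ v)
    (hcv : ∀ s s', R s s' → s' v 0 = s v 0)
    (hstart : ∀ s, Inv s 0 (s.put v 0 0))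
    (hstep : ∀ s i s₁ s₂, i < b.value s → s₁ v 0 = i → Inv s i s₁ → R s₁ s₂ →
      Inv s (i + 1) (s₂.put v 0 (i + 1))) :
    (Program.forLoop v b c).Implements fun s s' => Inv s (b.value s) s' := by
  obtain ⟨T, hT⟩ := hc.seq (write hv (.num 0) (.add (.read v (.num 0)) (.num 1)))
  refine ⟨3 + (Polynomial.X + 1) * (Polynomial.C (b.cost + 4) + T), fun s => ?_⟩
  let InvAt (m : ℕ) (s₁ : Store) : Prop :=
    Set.EqOn s s₁ (Set.Iio 2) ∧ s₁ v 0 + m = b.value s ∧ Inv s (s₁ v 0) s₁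
  obtain ⟨t, s', hrun, ht, hs, hv', hInv⟩ := exists_exec_loop (Inv := InvAt)
    (e := .sub b (.read v (.num 0))) (B := T.eval (inputSize s))
    (fun s₁ ⟨hs, hvar, _⟩ => by
      simp only [Expr.value, ← hb.value_congr hs]
      omega)
    (fun m s₁ ⟨hs, hvar, hInv⟩ => by
      obtain ⟨t, s₃, hrun, ht, hs', s₂, hR, rfl⟩ := hT s₁
      simp only [Expr.value, hcv _ _ hR] at hrun hs' ⊢
      refine ⟨by rw [← hb.value_congr hs]; omega, t, _, hrun, inputSize_congr hs ▸ ht,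
        hs.trans hs', ?_, ?_⟩
      · simp only [Store.put_apply_self, Function.update_self]
        omega
      · simpa only [Store.put_apply_self, Function.update_self] using
          hstep s _ s₁ s₂ (by omega) rfl hInv hR)
    (b.value s) (s.put v 0 0)
    ⟨s.eqOn_put hv 0 0, by simp [Store.put_apply_self], by
      simpa [Store.put_apply_self] using hstart s⟩
  refine ⟨_, s', .seq (.write s v (.num 0) (.num 0)) hrun, ?_, hs, ?_⟩
  · have hle := hb.value_le_inputSize s
    simp only [Expr.cost] at ht ⊢
    simp only [Polynomial.eval_add, Polynomial.eval_mul, Polynomial.eval_X, Polynomial.eval_C,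
      Polynomial.eval_one, Polynomial.eval_ofNat]
    calc 1 + 1 + 1 + t
        ≤ 3 + (b.value s + 1) * (b.cost + 4 + T.eval (inputSize s)) := by
          gcongr
      _ ≤ _ := by gcongr
  · rwa [show s' v 0 = b.value s by omega] at hInv
theorem length_le_bitSize (w : List ℕ) : w.length ≤ bitSize w := by
  induction w with
  | nil => simp
  | cons n w ih =>
    simp only [bitSize, List.map_cons, List.sum_cons, List.length_cons] at ih ⊢
    omega

theorem inputSize_input {w : List ℕ} (h0 : w.getD 0 0 ≤ w.length) (h1 : w.getD 1 0 ≤ w.length) :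
    inputSize (input w) = w.length := by
  have hlength : input w 1 0 = w.length := by simp [input]
  have h (i : ℕ) : input w 0 i = w.getD i 0 := by simp [input]
  rw [inputSize, hlength, h, h]
  omega

theorem solvableInPolyTime_of_implements {α : Type} {enc : α → List ℕ} {P : α → Prop}
    (h0 : ∀ x, (enc x).getD 0 0 ≤ (enc x).length) (h1 : ∀ x, (enc x).getD 1 0 ≤ (enc x).length)
    {c : Program}
    (hc : c.Implements fun s s' => ∀ x, s = input (enc x) →
      (P x → output s' = 1) ∧ (¬ P x → output s' = 0)) :
    SolvableInPolyTime enc P := by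
  obtain ⟨T, hT⟩ := hc
  refine ⟨c, T, fun x => ?_⟩
  obtain ⟨t, s, hrun, ht, -, hs⟩ := hT (input (enc x))
  refine ⟨t, s, hrun, ht.trans ?_, hs x rfl⟩
  rw [inputSize_input (h0 x) (h1 x), Polynomial.eval_eq_sum_range, Polynomial.eval_eq_sum_range]
  gcongr
  exact length_le_bitSize _

/-! ### Formulas with bounded counting quantifiers -/

/-- First-order formulas over the memory, with the quantifier that at least `e` of the numbers
below `b` satisfy `p`. A variable bound by a quantifier is stored in the cell `0` of an array, and
`p` is a function of the name of this array. -/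
inductive Formula : Type
  | lt (e f : Expr)
  | neg (p : Formula)
  | conj (p q : Formula)
  | atLeast (e b : Expr) (p : ℕ → Formula)

namespace Formula

open Classical in
/-- The formula holds in the store `s`, where the arrays from `D` on are free to hold the bound
variables. Of the two arrays `D` and `D + 1` used up by a quantifier, the first one is for the bound
variable and the second one for the counter of the compiled program. -/
noncomputable def Holds : Formula → ℕ → Store → Prop
  | .lt e f, _, s => e.value s < f.value s
  | .neg p, D, s => ¬ p.Holds D s
  | .conj p q, D, s => p.Holds D s ∧ q.Holds D s
  | .atLeast e b p, D, s =>
    e.value s ≤ Nat.count (fun i => (p D).Holds (D + 2) (s.put D 0 i)) (b.value s)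

/-- A program that evaluates the formula and leaves the truth value in the cell `0` of the
array `D`. -/
def compile : Formula → ℕ → Program
  | .lt e f, D => .write D (.num 0) (.sub (.num 1) (.sub (.add e (.num 1)) f))
  | .neg p, D => .seq (p.compile D) (.write D (.num 0) (.sub (.num 1) (.read D (.num 0))))
  | .conj p q, D => .seq (p.compile D) (.cond (.read D (.num 0)) (q.compile D) .skip)
  | .atLeast e b p, D =>
    .seq (.write (D + 1) (.num 0) (.num 0))
      (.seq
        (.forLoop D b
          (.seq ((p D).compile (D + 2))
            (.write (D + 1) (.num 0) (.add (.read (D + 1) (.num 0)) (.read (D + 2) (.num 0))))))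
        (.write D (.num 0) (.sub (.num 1) (.sub e (.read (D + 1) (.num 0))))))

end Formula

/-- The expression reads only arrays in `A`. -/
def Expr.ReadsIn (A : Set ℕ) : Expr → Prop
  | .num _ => True
  | .read x i => x ∈ A ∧ i.ReadsIn A
  | .add e f => e.ReadsIn A ∧ f.ReadsIn A
  | .sub e f => e.ReadsIn A ∧ f.ReadsIn A

theorem Expr.readsIn_entry {A : Set ℕ} {i : ℕ} : (Expr.entry i).ReadsIn A ↔ 0 ∈ A := by
  simp [Expr.entry, Expr.ReadsIn]

/-- The formula reads only arrays in `A` and its own bound variables, which are stored from the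
array `D` on, and its quantifiers have feasible bounds. -/
def Formula.ReadsIn : Formula → Set ℕ → ℕ → Prop
  | .lt e f, A, _ => e.ReadsIn A ∧ f.ReadsIn A
  | .neg p, A, D => p.ReadsIn A D
  | .conj p q, A, D => p.ReadsIn A D ∧ q.ReadsIn A D
  | .atLeast e b p, A, D => e.ReadsIn A ∧ (b.ReadsIn A ∧ b.IsLoopBound) ∧
      (p D).ReadsIn (insert D A) (D + 2)

/-- The stores agree except possibly on scalar variables, the cells `0` of arrays, outside `A`. -/
def AgreeOn (A : Set ℕ) (s s' : Store) : Prop :=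
  ∀ x i, (i = 0 → x ∈ A) → s x i = s' x i

namespace AgreeOn

variable {A B : Set ℕ} {s s' s'' : Store}

theorem refl (A : Set ℕ) (s : Store) : AgreeOn A s s := fun _ _ _ => rfl

theorem trans (h : AgreeOn A s s') (h' : AgreeOn A s' s'') : AgreeOn A s s'' :=
  fun x i hi => (h x i hi).trans (h' x i hi)

theorem mono (h : AgreeOn A s s') (hBA : B ⊆ A) : AgreeOn B s s' :=
  fun x i hi => h x i fun h0 => hBA (hi h0)

theorem apply_eq (h : AgreeOn A s s') {x : ℕ} (hx : x ∈ A) : s x = s' x :=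
  funext fun i => h x i fun _ => hx

theorem put_right {x : ℕ} (hx : x ∉ A) (h : AgreeOn A s s') (n : ℕ) :
    AgreeOn A s (s'.put x 0 n) := by
  intro y i hi
  rw [h y i hi, Store.put]
  by_cases hy : y = x
  · subst hy
    have hi0 : i ≠ 0 := fun h0 => hx (hi h0)
    rw [Function.update_self, Function.update_of_ne hi0]
  · rw [Function.update_of_ne hy]

theorem put_put (h : AgreeOn A s s') (x n : ℕ) :
    AgreeOn (insert x A) (s.put x 0 n) (s'.put x 0 n) := by
  intro y i hi
  by_cases hy : y = x
  · subst hy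
    simp only [Store.put_apply_self]
    by_cases hi0 : i = 0
    · simp [hi0]
    · rw [Function.update_of_ne hi0, Function.update_of_ne hi0]
      exact h y i fun h0 => absurd h0 hi0
  · rw [s.put_of_ne hy, s'.put_of_ne hy]
    exact h y i fun h0 => (hi h0).resolve_left hy

theorem value_congr (h : AgreeOn A s s') {e : Expr} (he : e.ReadsIn A) :
    e.value s = e.value s' := by
  induction e with
  | num n => rfl
  | read x i ih =>
    simp only [Expr.value, ih he.2]
    exact h _ _ fun _ => he.1
  | add e f ihe ihf => simp only [Expr.value, ihe he.1, ihf he.2]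
  | sub e f ihe ihf => simp only [Expr.value, ihe he.1, ihf he.2]

theorem holds_congr {p : Formula} : ∀ {A : Set ℕ} {D : ℕ} {s s' : Store}, AgreeOn A s s' →
    p.ReadsIn A D → (p.Holds D s ↔ p.Holds D s') := by
  induction p with
  | lt e f =>
    intro A D s s' h hp
    simp only [Formula.Holds, h.value_congr hp.1, h.value_congr hp.2]
  | neg p ih => exact fun h hp => not_congr (ih h hp)
  | conj p q ihp ihq => exact fun h hp => and_congr (ihp h hp.1) (ihq h hp.2)
  | atLeast e b p ih =>
    intro A D s s' h ⟨he, ⟨hb, _⟩, hp⟩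
    rw [Formula.Holds, Formula.Holds, h.value_congr he, h.value_congr hb]
    congr! 3 with i
    exact ih D (h.put_put D i) hp

end AgreeOn

open Classical in
/-- The program `c` decides the question `P` about the memory: it leaves the answer in the cell `0`
of the array `D` and changes nothing but scalar variables from `D` on. -/
def Program.Decides (c : Program) (D : ℕ) (P : Store → Prop) : Prop :=
  c.Implements fun s s' => AgreeOn (Set.Iio D) s s' ∧ s' D 0 = if P s then 1 else 0

namespace Program.Decides

variable {c d : Program} {D : ℕ} {P Q : Store → Prop}

theorem neg (hD : 2 ≤ D) (hc : c.Decides D P) :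
    (Program.seq c (.write D (.num 0) (.sub (.num 1) (.read D (.num 0))))).Decides D
      fun s => ¬ P s := by
  refine (hc.seq (.write hD _ _)).mono ?_
  rintro s _ ⟨s₁, ⟨hs, hP⟩, rfl⟩
  refine ⟨hs.put_right (by simp) _, ?_⟩
  simp only [Store.put_apply_self, Expr.value, hP, Function.update_self]
  by_cases h : P s <;> simp [h]

theorem conj (hQ : ∀ s s', AgreeOn (Set.Iio D) s s' → (Q s ↔ Q s')) (hc : c.Decides D P)
    (hd : d.Decides D Q) :
    (Program.seq c (.cond (.read D (.num 0)) d .skip)).Decides D fun s => P s ∧ Q s := by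
  refine (hc.seq (.cond _ hd .skip)).mono ?_
  rintro s s' ⟨s₁, ⟨hs, hP⟩, hfst, hsnd⟩
  simp only [Expr.value, hP] at hfst hsnd
  by_cases h : P s
  · obtain ⟨hs', hans⟩ := hfst (by simp [h])
    refine ⟨hs.trans hs', hans.trans ?_⟩
    congr 1
    simp [h, hQ s s₁ hs]
  · obtain rfl := hsnd (by simp [h])
    exact ⟨hs, by simp [hP, h]⟩

open Classical in
theorem count {b : Expr} (hD : 2 ≤ D) (hb : b.IsLoopBound)
    (hP : ∀ s s', AgreeOn (Set.Iio (D + 1)) s s' → (P s ↔ P s')) (hc : c.Decides (D + 2) P) :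
    (Program.forLoop D b (.seq c (.write (D + 1) (.num 0)
      (.add (.read (D + 1) (.num 0)) (.read (D + 2) (.num 0)))))).Implements fun s s' =>
        AgreeOn (Set.Iio D) s s' ∧
          s' (D + 1) 0 = s (D + 1) 0 + Nat.count (fun i => P (s.put D 0 i)) (b.value s) := by
  refine Implements.forLoop
    (Inv := fun s i s₁ => AgreeOn (Set.Iio D) s s₁ ∧
      s₁ (D + 1) 0 = s (D + 1) 0 + Nat.count (fun i => P (s.put D 0 i)) i)
    (hc.seq (.write (by omega) _ _)) hb hD ?_ ?_ ?_
  · rintro s _ ⟨s₁, ⟨hs, -⟩, rfl⟩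
    rw [Store.put_of_ne _ (by omega), hs.apply_eq (x := D) (by simp)]
  · exact fun s => ⟨(AgreeOn.refl _ s).put_right (by simp) 0, by
      rw [s.put_of_ne (by omega), Nat.count_zero, add_zero]⟩
  · rintro s i s₁ _ - hi ⟨hs, hcount⟩ ⟨s₂, ⟨hs', hans⟩, rfl⟩
    have hvar : AgreeOn (Set.Iio (D + 1)) (s.put D 0 i) s₁ := by
      subst hi
      rw [show Set.Iio (D + 1) = insert D (Set.Iio D) from Order.Iio_succ_eq_insert D]
      simpa only [Store.put_eq_self] using hs.put_put D (s₁ D 0)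
    refine ⟨((hs.trans (hs'.mono ?_)).put_right (by simp) _).put_right (by simp) _, ?_⟩
    · exact Set.Iio_subset_Iio (by omega)
    · rw [Store.put_of_ne _ (by omega), Store.put_apply_self]
      simp only [Expr.value, Function.update_self]
      rw [Nat.count_succ, hans, ← hs'.apply_eq (x := D + 1) (by simp), hcount, add_assoc]
      simp only [hP _ _ hvar]

open Classical in
theorem atLeast {e b : Expr} (hD : 2 ≤ D) (hb : b.IsLoopBound)
    (he : ∀ s s', AgreeOn (Set.Iio D) s s' → e.value s = e.value s')
    (hP : ∀ s s', AgreeOn (Set.Iio (D + 1)) s s' → (P s ↔ P s')) (hc : c.Decides (D + 2) P) :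
    (Program.seq (.write (D + 1) (.num 0) (.num 0))
      (.seq
        (.forLoop D b (.seq c (.write (D + 1) (.num 0)
          (.add (.read (D + 1) (.num 0)) (.read (D + 2) (.num 0))))))
        (.write D (.num 0) (.sub (.num 1) (.sub e (.read (D + 1) (.num 0))))))).Decides D
      fun s => e.value s ≤ Nat.count (fun i => P (s.put D 0 i)) (b.value s) := by
  refine ((Implements.write (by omega) _ _).seq
    ((hc.count hD hb hP).seq (.write hD _ _))).mono ?_
  rintro (s : Store) _ ⟨_, rfl, s₁, ⟨hs, hcount⟩, rfl⟩
  have hreset {A : Set ℕ} (hA : D + 1 ∉ A) : AgreeOn A s (s.put (D + 1) 0 0) :=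
    (AgreeOn.refl A s).put_right hA 0
  have hs' : AgreeOn (Set.Iio D) s s₁ := (hreset (by simp)).trans hs
  have hP' (i : ℕ) : P ((s.put (D + 1) 0 0).put D 0 i) ↔ P (s.put D 0 i) :=
    (hP _ _ (((hreset (by simp)).put_put D i).mono (Set.subset_insert D _))).symm
  refine ⟨hs'.put_right (by simp) _, ?_⟩
  simp only [Expr.value, Store.put_apply_self, Function.update_self, Nat.zero_add, hP',
    ← hb.value_congr (s.eqOn_put (show 2 ≤ D + 1 by omega) 0 0)] at hcount ⊢
  rw [hcount, ← he s s₁ hs']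
  split_ifs <;> omega

end Program.Decides

theorem Formula.decides_compile {p : Formula} : ∀ {A : Set ℕ} {D : ℕ}, 2 ≤ D → A ⊆ Set.Iio D →
    p.ReadsIn A D → (p.compile D).Decides D (p.Holds D) := by
  induction p with
  | lt e f =>
    intro A D hD _ _
    refine (Program.Implements.write hD _ _).mono ?_
    rintro s _ rfl
    refine ⟨(AgreeOn.refl _ s).put_right (by simp) _, ?_⟩
    simp only [Store.put_apply_self, Expr.value, Function.update_self]
    by_cases h : Formula.Holds (.lt e f) D s
    · rw [if_pos h]
      have := show e.value s < f.value s from h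
      omega
    · rw [if_neg h]
      have := show ¬ e.value s < f.value s from h
      omega
  | neg p ih => exact fun hD hA hp => (ih hD hA hp).neg hD
  | conj p q ihp ihq =>
    exact fun hD hA hp => (ihp hD hA hp.1).conj
      (fun _ _ h => (h.mono hA).holds_congr hp.2) (ihq hD hA hp.2)
  | atLeast e b p ih =>
    intro A D hD hA ⟨he, ⟨_, hb⟩, hp⟩
    have hA' : insert D A ⊆ Set.Iio (D + 1) :=
      Set.insert_subset (by simp) (hA.trans (Set.Iio_subset_Iio (by omega)))
    exact Program.Decides.atLeast hD hb (fun _ _ h => (h.mono hA).value_congr he)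
      (fun _ _ h => (h.mono hA').holds_congr hp)
      (ih D (by omega) (hA'.trans (Set.Iio_subset_Iio (by omega))) hp)

/-- The scalar variable `x`. -/
def Expr.var (x : ℕ) : Expr := .read x (.num 0)

namespace Formula

/-- The formula `e = f`. -/
def eq (e f : Expr) : Formula := .conj (.neg (.lt f e)) (.neg (.lt e f))

/-- The disjunction of two formulas. -/
def disj (p q : Formula) : Formula := .neg (.conj (.neg p) (.neg q))

/-- The implication between two formulas. -/
def imp (p q : Formula) : Formula := .neg (.conj p (.neg q))

/-- Existential quantification over the numbers below `b`. -/
def ex (b : Expr) (p : ℕ → Formula) : Formula := .atLeast (.num 1) b p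

/-- Universal quantification over the numbers below `b`. -/
def all (b : Expr) (p : ℕ → Formula) : Formula := .neg (.ex b fun x => .neg (p x))

variable {p q : Formula} {P Q : Prop} {D : ℕ} {s : Store}

theorem holds_eq (e f : Expr) (D : ℕ) (s : Store) :
    (eq e f).Holds D s ↔ e.value s = f.value s := by
  simp only [eq, Holds]
  omega

theorem holds_conj (hp : p.Holds D s ↔ P) (hq : q.Holds D s ↔ Q) :
    (conj p q).Holds D s ↔ P ∧ Q :=
  and_congr hp hq

theorem holds_disj (hp : p.Holds D s ↔ P) (hq : q.Holds D s ↔ Q) :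
    (disj p q).Holds D s ↔ P ∨ Q := by
  simp only [disj, Holds, hp, hq]
  tauto

theorem holds_imp (hp : p.Holds D s ↔ P) (hq : q.Holds D s ↔ Q) :
    (imp p q).Holds D s ↔ (P → Q) := by
  simp only [imp, Holds, hp, hq]
  tauto

variable {b : Expr} {p : ℕ → Formula} {n : ℕ} {P : Fin n → Prop}

open Classical in
theorem holds_atLeast (e : Expr) (hb : b.value s = n)
    (hp : ∀ i : Fin n, (p D).Holds (D + 2) (s.put D 0 i) ↔ P i) :
    (atLeast e b p).Holds D s ↔ e.value s ≤ (Finset.univ.filter P).card := by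
  simp only [Holds, hb, Nat.count_eq_card_filter_range, Finset.card_filter, ← hp,
    Finset.sum_range]

theorem holds_ex (hb : b.value s = n)
    (hp : ∀ i : Fin n, (p D).Holds (D + 2) (s.put D 0 i) ↔ P i) :
    (ex b p).Holds D s ↔ ∃ i, P i := by
  classical
  rw [ex, holds_atLeast _ hb hp, Expr.value, Nat.one_le_iff_ne_zero, Finset.card_ne_zero,
    Finset.filter_nonempty_iff]
  simp

theorem holds_all (hb : b.value s = n)
    (hp : ∀ i : Fin n, (p D).Holds (D + 2) (s.put D 0 i) ↔ P i) :
    (all b p).Holds D s ↔ ∀ i, P i := by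
  have hneg : (ex b fun x => neg (p x)).Holds D s ↔ ∃ i, ¬ P i :=
    holds_ex hb fun i => not_congr (hp i)
  rw [all, Holds, hneg, not_exists_not]

end Formula

end RAM

/-! ### Stable matchings -/

namespace SchoolInstance

variable {I : SchoolInstance} {M N : Fin I.nA → Option (Fin I.nB)} {a a' : Fin I.nA} {b : Fin I.nB}

theorem mem_assigned : a ∈ I.assigned M b ↔ M a = some b := by
  simp [assigned]

theorem studentPrefers_of_le_of_ne {x y : Option (Fin I.nB)}
    (hle : I.studentRank a x ≤ I.studentRank a y) (hne : x ≠ y) : I.StudentPrefers a x y :=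
  hle.lt_of_ne ((I.studentRank a).injective.ne hne)

theorem schoolPrefers_of_not {x y : Option (Fin I.nA)} (h : ¬ I.SchoolPrefers b x y)
    (hne : x ≠ y) : I.SchoolPrefers b y x :=
  (not_lt.1 h).lt_of_ne ((I.schoolRank b).injective.ne hne.symm)

theorem SchoolPrefers.ne {x y : Option (Fin I.nA)} (h : I.SchoolPrefers b x y) : x ≠ y := by
  rintro rfl
  exact lt_irrefl _ h

theorem StudentPrefers.trans_le {x y z : Option (Fin I.nB)} (h : I.StudentPrefers a x y)
    (h' : I.studentRank a y ≤ I.studentRank a z) : I.StudentPrefers a x z :=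
  lt_of_lt_of_le h h'

theorem IsStable.eligible (hM : I.IsStable M) (hab : M a = some b) : I.Eligible a b := by
  have hle := not_lt.1 (hM.2.2.1 a)
  rw [hab] at hle
  exact studentPrefers_of_le_of_ne hle (by simp)

theorem IsStable.not_schoolPrefers (hM : I.IsStable M) (ha : I.StudentPrefers a (some b) (M a))
    (hb : M a' = some b) : ¬ I.SchoolPrefers b (some a) (some a') :=
  fun h => hM.2.1 a b ⟨ha, some a', .inl ⟨a', mem_assigned.2 hb, rfl⟩, h⟩

theorem IsStable.quota_le_card_assigned (hM : I.IsStable M)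
    (ha : I.StudentPrefers a (some b) (M a)) (hb : I.SchoolPrefers b (some a) none) :
    I.quota b ≤ (I.assigned M b).card :=
  not_lt.1 fun h => hM.2.1 a b ⟨ha, none, .inr ⟨rfl, h⟩, hb⟩

theorem sum_card_assigned (M : Fin I.nA → Option (Fin I.nB)) :
    ∑ b, (I.assigned M b).card = (Finset.univ.filter fun a => M a ≠ none).card := by
  simp only [assigned, Finset.card_filter]
  rw [Finset.sum_comm]
  refine Finset.sum_congr rfl fun a _ => ?_
  cases M a <;> simp

theorem card_assigned_eq_of_le (hle : ∀ b, (I.assigned M b).card ≤ (I.assigned N b).card)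
    (hnone : ∀ a, M a = none → N a = none) (b : Fin I.nB) :
    (I.assigned M b).card = (I.assigned N b).card := by
  have hsum : ∑ b, (I.assigned M b).card = ∑ b, (I.assigned N b).card := by
    refine le_antisymm (Finset.sum_le_sum fun b _ => hle b) ?_
    rw [sum_card_assigned, sum_card_assigned]
    exact Finset.card_le_card fun a ha => by simpa using mt (hnone a) (by simpa using ha)
  exact (Finset.sum_eq_sum_iff_of_le fun b _ => hle b).1 hsum b (Finset.mem_univ b)

/-- Every student likes her partner in `M` at least as much as her partner in `N`. -/
def Dominates (M N : Fin I.nA → Option (Fin I.nB)) : Prop :=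
  ∀ a, I.studentRank a (M a) ≤ I.studentRank a (N a)

/-- No student is assigned to a class for which she is not eligible. -/
def Acceptable (M : Fin I.nA → Option (Fin I.nB)) : Prop :=
  Dominates M fun _ => none

theorem Dominates.studentPrefers (h : Dominates M N) (hab : M a = some b) (hne : N a ≠ some b) :
    I.StudentPrefers a (some b) (N a) :=
  studentPrefers_of_le_of_ne (hab ▸ h a) hne.symm

theorem IsStable.acceptable (hM : I.IsStable M) : Acceptable M :=
  fun a => not_lt.1 (hM.2.2.1 a)

theorem Acceptable.eligible (hM : Acceptable M) (hab : M a = some b) : I.Eligible a b :=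
  Dominates.studentPrefers hM hab (by simp)

end SchoolInstance

/-! ### Siblings -/

/-- A school matching instance with siblings whose classes are grouped into `k` activities, such
that siblings rank the activities for which both are eligible in the same order. -/
structure SiblingInstance extends SchoolInstance where
  siblings : Finset (Fin nA × Fin nA)
  k : ℕ
  activity : Fin nB → Fin k
  same_order : ∀ p ∈ siblings, ∀ b₁ b₂ b₁' b₂' : Fin nB,
    toSchoolInstance.Eligible p.1 b₁ → toSchoolInstance.Eligible p.1 b₂ →
    toSchoolInstance.Eligible p.2 b₁' → toSchoolInstance.Eligible p.2 b₂' →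
    activity b₁ = activity b₁' → activity b₂ = activity b₂' →
      (toSchoolInstance.StudentPrefers p.1 (some b₁) (some b₂) ↔
        toSchoolInstance.StudentPrefers p.2 (some b₁') (some b₂'))

namespace SiblingInstance

open SchoolInstance

/-- A stable matching that assigns both members of each pair of siblings to classes, of the same
activity. -/
def IsActivityStable (I : SiblingInstance) (M : Fin I.nA → Option (Fin I.nB)) : Prop :=
  I.IsStable M ∧ ∀ p ∈ I.siblings, ∃ b₁ b₂ : Fin I.nB,
    M p.1 = some b₁ ∧ M p.2 = some b₂ ∧ I.activity b₁ = I.activity b₂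

/-- The symmetric closure of the set of pairs of siblings. -/
def Sib (I : SiblingInstance) (a a' : Fin I.nA) : Prop :=
  (a, a') ∈ I.siblings ∨ (a', a) ∈ I.siblings

variable {I : SiblingInstance} {M N : Fin I.nA → Option (Fin I.nB)} {a a' : Fin I.nA}
  {b b' : Fin I.nB}

theorem Sib.symm (h : I.Sib a a') : I.Sib a' a := Or.symm h

theorem IsActivityStable.exists_of_sib (hM : I.IsActivityStable M) (h : I.Sib a a') :
    ∃ b b', M a = some b ∧ M a' = some b' ∧ I.activity b = I.activity b' := by
  rcases h with h | h
  · exact hM.2 _ h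
  · obtain ⟨b, b', hb, hb', hact⟩ := hM.2 _ h
    exact ⟨b', b, hb', hb, hact.symm⟩

/-! ### Forced moves -/

variable (I) in
open Classical in
/-- The reasons why no activity-stable matching that is dominated by `M` assigns the student `a` to
the class `b`. -/
inductive Rejects (M : Fin I.nA → Option (Fin I.nB)) (a : Fin I.nA) (b : Fin I.nB) : Prop
  | unacceptable (h : I.SchoolPrefers b none (some a))
  | overbid (h : I.quota b ≤
      ((I.assigned M b).filter fun a' => I.SchoolPrefers b (some a') (some a)).card)
  | passed (a' : Fin I.nA) (ha' : I.StudentPrefers a' (some b) (M a'))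
      (hb : I.SchoolPrefers b (some a') (some a))
  | sibling (a' : Fin I.nA) (hsib : I.Sib a a')
      (ha' : ∀ b', I.activity b' = I.activity b → I.Eligible a' b' →
        I.StudentPrefers a' (some b') (M a'))

open Classical in
theorem rejects_iff : I.Rejects M a b ↔
    I.SchoolPrefers b none (some a) ∨
    I.quota b ≤ ((I.assigned M b).filter fun a' => I.SchoolPrefers b (some a') (some a)).card ∨
    (∃ a', I.StudentPrefers a' (some b) (M a') ∧ I.SchoolPrefers b (some a') (some a)) ∨
    ∃ a', I.Sib a a' ∧ ∀ b', I.activity b' = I.activity b → I.Eligible a' b' →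
      I.StudentPrefers a' (some b') (M a') := by
  constructor
  · rintro (h | h | ⟨a', h, h'⟩ | ⟨a', h, h'⟩)
    exacts [.inl h, .inr (.inl h), .inr (.inr (.inl ⟨a', h, h'⟩)), .inr (.inr (.inr ⟨a', h, h'⟩))]
  · rintro (h | h | ⟨a', h, h'⟩ | ⟨a', h, h'⟩)
    exacts [.unacceptable h, .overbid h, .passed a' h h', .sibling a' h h']

variable (I) in
/-- In `M`, the student `a` is assigned to a class that rejects her. -/
def IsRejected (M : Fin I.nA → Option (Fin I.nB)) (a : Fin I.nA) : Prop :=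
  ∃ b, M a = some b ∧ I.Rejects M a b

variable (I) in
/-- No rejection in a matching that dominates `N` takes a student away from her partner in `N`. -/
def RejectionProof (N : Fin I.nA → Option (Fin I.nB)) : Prop :=
  ∀ M a b, Dominates M N → I.Rejects M a b → N a ≠ some b

theorem rejectionProof_none : I.RejectionProof fun _ => none :=
  fun _ _ _ _ _ => by simp

theorem IsActivityStable.rejectionProof (hN : I.IsActivityStable N) : I.RejectionProof N := by
  classical
  rintro M a b hMN hrej hab
  obtain hunacc | hquota | ⟨a', ha', hb⟩ | ⟨a', hsib, ha'⟩ := hrej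
  · exact hN.1.2.2.2 b ⟨a, mem_assigned.2 hab, hunacc⟩
  · set S := (I.assigned M b).filter fun a' => I.SchoolPrefers b (some a') (some a)
    have haS : a ∉ S := fun ha => (Finset.mem_filter.1 ha).2.ne rfl
    have hS : insert a S ⊆ I.assigned N b := by
      refine Finset.insert_subset (mem_assigned.2 hab) fun a' ha' => mem_assigned.2 ?_
      obtain ⟨hM, hpref⟩ := Finset.mem_filter.1 ha'
      by_contra hne
      exact hN.1.not_schoolPrefers (hMN.studentPrefers (mem_assigned.1 hM) hne) hab hpref
    have hcard := Finset.card_le_card hS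
    rw [Finset.card_insert_of_notMem haS] at hcard
    have := hN.1.1 b
    omega
  · exact hN.1.not_schoolPrefers (ha'.trans_le (hMN a')) hab hb
  · obtain ⟨b₁, b', hb₁, hb', hact⟩ := hN.exists_of_sib hsib
    obtain rfl : b = b₁ := Option.some.inj (hab.symm.trans hb₁)
    have hlt := ha' b' hact.symm (hN.1.eligible hb')
    exact (hlt.trans_le (hMN a')).ne (by rw [hb'])

variable (I) in
open Classical in
/-- Moves the student `a` to the next option on her list if she is rejected. The successor in
`Fin (I.nB + 1)` does not wrap around in this case if `M` is acceptable, as then the rank of the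
rejecting class is below that of the outside option. -/
noncomputable def advance (M : Fin I.nA → Option (Fin I.nB)) (a : Fin I.nA) :
    Fin I.nA → Option (Fin I.nB) :=
  if I.IsRejected M a then
    Function.update M a ((I.studentRank a).symm (I.studentRank a (M a) + 1))
  else M

theorem advance_of_isRejected (h : I.IsRejected M a) : I.advance M a =
    Function.update M a ((I.studentRank a).symm (I.studentRank a (M a) + 1)) := if_pos h

theorem advance_of_not_isRejected (h : ¬ I.IsRejected M a) : I.advance M a = M := if_neg h

theorem RejectionProof.dominates_advance (hN : I.RejectionProof N) (hMN : Dominates M N)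
    (a : Fin I.nA) : Dominates (I.advance M a) N := by
  by_cases h : I.IsRejected M a
  · obtain ⟨b, hab, hrej⟩ := h
    intro a'
    rw [advance_of_isRejected ⟨b, hab, hrej⟩]
    by_cases ha' : a' = a
    · subst ha'
      rw [Function.update_self, Equiv.apply_symm_apply, hab]
      exact Fin.add_one_le_of_lt (hMN.studentPrefers hab (hN M a' b hMN hrej))
    · rw [Function.update_of_ne ha']
      exact hMN a'
  · rwa [advance_of_not_isRejected h]

theorem RejectionProof.dominates_foldl_advance (hN : I.RejectionProof N) (hMN : Dominates M N)
    (l : List (Fin I.nA)) : Dominates (l.foldl I.advance M) N := by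
  induction l generalizing M with
  | nil => exact hMN
  | cons a l ih => exact ih (hN.dominates_advance hMN a)

variable (I) in
/-- Considers the students one after the other and moves those that are rejected. -/
noncomputable def sweep (M : Fin I.nA → Option (Fin I.nB)) : Fin I.nA → Option (Fin I.nB) :=
  (List.finRange I.nA).foldl I.advance M

variable (I) in
/-- Assigns each student to her favourite. -/
def favourites : Fin I.nA → Option (Fin I.nB) := fun a => (I.studentRank a).symm 0

theorem RejectionProof.dominates_iterate_sweep (hN : I.RejectionProof N) (n : ℕ) :
    Dominates (I.sweep^[n] I.favourites) N := by
  induction n with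
  | zero => exact fun a => by simp [favourites]
  | succ n ih =>
    rw [Function.iterate_succ_apply']
    exact hN.dominates_foldl_advance ih _

theorem acceptable_iterate_sweep (n : ℕ) : Acceptable (I.sweep^[n] I.favourites) :=
  rejectionProof_none.dominates_iterate_sweep n

/-! ### Termination -/

variable (I) in
/-- The total number of moves that lead from the favourites of the students to `M`. -/
def weight (M : Fin I.nA → Option (Fin I.nB)) : ℕ := ∑ a, (I.studentRank a (M a) : ℕ)

theorem weight_le (M : Fin I.nA → Option (Fin I.nB)) : I.weight M ≤ I.nA * I.nB := by
  calc I.weight M ≤ ∑ _ : Fin I.nA, I.nB := Finset.sum_le_sum fun a _ => Fin.is_le _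
    _ = I.nA * I.nB := by simp

theorem IsRejected.rank_advance (hM : Acceptable M) (h : I.IsRejected M a) :
    (I.studentRank a (I.advance M a a) : ℕ) = I.studentRank a (M a) + 1 := by
  rw [advance_of_isRejected h, Function.update_self, Equiv.apply_symm_apply]
  obtain ⟨b, hab, -⟩ := h
  rw [hab]
  exact Fin.val_add_one_of_lt (lt_of_lt_of_le (hM.eligible hab) (Fin.le_last _))

theorem advance_of_ne (h : a' ≠ a) : I.advance M a a' = M a' := by
  by_cases hrej : I.IsRejected M a
  · rw [advance_of_isRejected hrej, Function.update_of_ne h]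
  · rw [advance_of_not_isRejected hrej]

theorem IsRejected.weight_lt (hM : Acceptable M) (h : I.IsRejected M a) :
    I.weight M < I.weight (I.advance M a) := by
  refine Finset.sum_lt_sum (fun a' _ => ?_) ⟨a, Finset.mem_univ a, ?_⟩
  · by_cases ha' : a' = a
    · subst ha'
      rw [h.rank_advance hM]
      omega
    · rw [advance_of_ne ha']
  · rw [h.rank_advance hM]
    omega

theorem weight_le_weight_foldl_advance (hM : Acceptable M) (l : List (Fin I.nA)) :
    I.weight M ≤ I.weight (l.foldl I.advance M) := by
  induction l generalizing M with
  | nil => exact le_rfl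
  | cons a l ih =>
    refine le_trans ?_ (ih (rejectionProof_none.dominates_advance hM a))
    by_cases h : I.IsRejected M a
    · exact (h.weight_lt hM).le
    · rw [advance_of_not_isRejected h]

theorem weight_lt_weight_foldl_advance (hM : Acceptable M) {l : List (Fin I.nA)} (ha : a ∈ l)
    (h : I.IsRejected M a) : I.weight M < I.weight (l.foldl I.advance M) := by
  induction l with
  | nil => simp at ha
  | cons a' l ih =>
    by_cases ha' : I.IsRejected M a'
    · exact (ha'.weight_lt hM).trans_le
        (weight_le_weight_foldl_advance (rejectionProof_none.dominates_advance hM a') l)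
    · rw [List.foldl_cons, advance_of_not_isRejected ha']
      refine ih ((List.mem_cons.1 ha).resolve_left ?_)
      rintro rfl
      exact ha' h

theorem sweep_eq_self (h : ∀ a, ¬ I.IsRejected M a) : I.sweep M = M := by
  have hfold (l : List (Fin I.nA)) : l.foldl I.advance M = M := by
    induction l with
    | nil => rfl
    | cons a l ih => rwa [List.foldl_cons, advance_of_not_isRejected (h a)]
  exact hfold _

theorem forall_not_isRejected_or_le_weight (n : ℕ) :
    (∀ a, ¬ I.IsRejected (I.sweep^[n] I.favourites) a) ∨
      n ≤ I.weight (I.sweep^[n] I.favourites) := by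
  induction n with
  | zero => exact .inr (Nat.zero_le _)
  | succ n ih =>
    rw [Function.iterate_succ_apply']
    by_cases h : ∀ a, ¬ I.IsRejected (I.sweep^[n] I.favourites) a
    · exact .inl (by rwa [sweep_eq_self h])
    · obtain ⟨a, ha⟩ := not_forall_not.1 h
      exact .inr ((ih.resolve_left h).trans_lt
        (weight_lt_weight_foldl_advance (acceptable_iterate_sweep n) (List.mem_finRange a) ha))

theorem not_isRejected_iterate_sweep {n : ℕ} (hn : I.nA * I.nB < n) (a : Fin I.nA) :
    ¬ I.IsRejected (I.sweep^[n] I.favourites) a :=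
  (forall_not_isRejected_or_le_weight n).resolve_right
    (fun h => absurd (h.trans (weight_le _)) (not_le.2 hn)) a

/-! ### The final assignment -/

theorem card_assigned_le_quota (hrej : ∀ a, ¬ I.IsRejected M a) (b : Fin I.nB) :
    (I.assigned M b).card ≤ I.quota b := by
  classical
  obtain hempty | hne := (I.assigned M b).eq_empty_or_nonempty
  · simp [hempty]
  obtain ⟨a, ha, hworst⟩ := Finset.exists_max_image _ (fun a => I.schoolRank b (some a)) hne
  have hbetter : (I.assigned M b).erase a ⊆
      (I.assigned M b).filter fun a' => I.SchoolPrefers b (some a') (some a) := by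
    intro a' ha'
    obtain ⟨hne, ha'⟩ := Finset.mem_erase.1 ha'
    exact Finset.mem_filter.2 ⟨ha', schoolPrefers_of_not (not_lt.2 (hworst a' ha'))
      (by simpa using Ne.symm hne)⟩
  have hcard := Finset.card_le_card hbetter
  rw [Finset.card_erase_of_mem ha] at hcard
  by_contra hlt
  exact hrej a ⟨b, mem_assigned.1 ha, .overbid (by omega)⟩

variable (I) in
/-- The condition under which the final assignment of the algorithm is activity-stable. -/
structure Succeeds (M : Fin I.nA → Option (Fin I.nB)) : Prop where
  full : ∀ a b, I.StudentPrefers a (some b) (M a) → I.SchoolPrefers b (some a) none →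
    I.quota b ≤ (I.assigned M b).card
  siblings_assigned : ∀ a a', I.Sib a a' → M a ≠ none

theorem IsActivityStable.card_assigned_le (hN : I.IsActivityStable N) (hMN : Dominates M N)
    (hrej : ∀ a, ¬ I.IsRejected M a) (b : Fin I.nB) :
    (I.assigned M b).card ≤ (I.assigned N b).card := by
  by_cases hsub : I.assigned M b ⊆ I.assigned N b
  · exact Finset.card_le_card hsub
  obtain ⟨a, haM, haN⟩ := Finset.not_subset.1 hsub
  rw [mem_assigned] at haM haN
  have hacc : I.SchoolPrefers b (some a) none :=
    schoolPrefers_of_not (fun h => hrej a ⟨b, haM, .unacceptable h⟩) (by simp)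
  exact (card_assigned_le_quota hrej b).trans
    (hN.1.quota_le_card_assigned (hMN.studentPrefers haM haN) hacc)

theorem IsActivityStable.succeeds (hN : I.IsActivityStable N) (hMN : Dominates M N)
    (hrej : ∀ a, ¬ I.IsRejected M a) : I.Succeeds M := by
  have hnone (a : Fin I.nA) (ha : M a = none) : N a = none := by
    have hle := ha ▸ hMN a
    exact (I.studentRank a).injective (le_antisymm (hN.1.acceptable a) hle)
  refine ⟨fun a b ha hb => ?_, fun a a' hsib ha => ?_⟩
  · rw [card_assigned_eq_of_le (hN.card_assigned_le hMN hrej) hnone b]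
    exact hN.1.quota_le_card_assigned (ha.trans_le (hMN a)) hb
  · obtain ⟨b, _, hb, -⟩ := hN.exists_of_sib hsib
    exact absurd (hb.symm.trans (hnone a ha)) (by simp)

theorem Succeeds.isStable (h : I.Succeeds M) (hM : Acceptable M)
    (hrej : ∀ a, ¬ I.IsRejected M a) : I.IsStable M := by
  refine ⟨card_assigned_le_quota hrej, ?_, fun a => not_lt.2 (hM a), ?_⟩
  · rintro a b ⟨ha, x, ⟨a', ha', rfl⟩ | ⟨rfl, hfree⟩, hx⟩
    · exact hrej a' ⟨b, mem_assigned.1 ha', .passed a ha hx⟩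
    · exact hfree.not_ge (h.full a b ha hx)
  · rintro b ⟨a, ha, hunacc⟩
    exact hrej a ⟨b, mem_assigned.1 ha, .unacceptable hunacc⟩

theorem exists_eligible_of_sib (hrej : ∀ a, ¬ I.IsRejected M a) (hab : M a = some b)
    (hsib : I.Sib a a') : ∃ b', I.activity b' = I.activity b ∧ I.Eligible a' b' ∧
      ¬ I.StudentPrefers a' (some b') (M a') := by
  by_contra! h
  exact hrej a ⟨b, hab, .sibling a' hsib h⟩

theorem Succeeds.isActivityStable (h : I.Succeeds M) (hM : Acceptable M)
    (hrej : ∀ a, ¬ I.IsRejected M a) : I.IsActivityStable M := by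
  refine ⟨h.isStable hM hrej, ?_⟩
  rintro ⟨a, a'⟩ hp
  have hsib : I.Sib a a' := .inl hp
  obtain ⟨b, hb⟩ := Option.ne_none_iff_exists'.1 (h.siblings_assigned a a' hsib)
  obtain ⟨b', hb'⟩ := Option.ne_none_iff_exists'.1 (h.siblings_assigned a' a hsib.symm)
  obtain ⟨c', hc', helig', hnot'⟩ := exists_eligible_of_sib hrej hb hsib
  obtain ⟨c, hc, helig, hnot⟩ := exists_eligible_of_sib hrej hb' hsib.symm
  rw [hb'] at hnot'
  rw [hb] at hnot
  refine ⟨b, b', hb, hb', ?_⟩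
  by_contra hact
  have hbc : I.StudentPrefers a (some b) (some c) :=
    studentPrefers_of_le_of_ne (not_lt.1 hnot) fun hbc => hact (by rw [Option.some.inj hbc, hc])
  exact hnot' ((I.same_order (a, a') hp b c c' b' (hM.eligible hb) helig helig' (hM.eligible hb')
    hc'.symm hc).1 hbc)

theorem exists_isActivityStable_iff {n : ℕ} (hn : I.nA * I.nB < n) :
    (∃ N, I.IsActivityStable N) ↔ I.Succeeds (I.sweep^[n] I.favourites) := by
  have hrej := not_isRejected_iterate_sweep hn
  constructor
  · rintro ⟨N, hN⟩
    exact hN.succeeds (hN.rejectionProof.dominates_iterate_sweep n) hrej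
  · exact fun h => ⟨_, h.isActivityStable (acceptable_iterate_sweep n) hrej⟩

end SiblingInstance

/-! ### Positions in the encoding -/

namespace RAM

/-- The entries of `w` from position `n` on begin with `l`. -/
def OccursAt (w : List ℕ) (n : ℕ) (l : List ℕ) : Prop := l <+: w.drop n

variable {w l l' : List ℕ} {n : ℕ}

theorem OccursAt.getD (h : OccursAt w n l) {i : ℕ} (hi : i < l.length) :
    w.getD (n + i) 0 = l.getD i 0 := by
  obtain ⟨v, hv⟩ := h
  rw [List.getD_eq_getElem?_getD, ← List.getElem?_drop, ← hv, ← List.getD_eq_getElem?_getD,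
    List.getD_append _ _ _ _ hi]

theorem OccursAt.trans (h : OccursAt w n l) {m : ℕ} (h' : OccursAt l m l') :
    OccursAt w (n + m) l' := by
  have hprefix := List.IsPrefix.trans h' (h.drop m)
  rwa [List.drop_drop] at hprefix

theorem occursAt_append (u l : List ℕ) : OccursAt (u ++ l) u.length l := by
  simp [OccursAt]

theorem OccursAt.append (h : OccursAt w n l) (v : List ℕ) : OccursAt (w ++ v) n l := by
  rw [OccursAt, List.drop_append]
  exact List.IsPrefix.trans h (List.prefix_append _ _)

theorem occursAt_flatMap {α : Type*} {f : α → List ℕ} {m : ℕ} (hf : ∀ x, (f x).length = m)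
    (l : List α) : ∀ {i : ℕ} (hi : i < l.length), OccursAt (l.flatMap f) (i * m) (f l[i]) := by
  induction l with
  | nil => exact fun hi => absurd hi (by simp)
  | cons x l ih =>
    rintro (_ | i) hi
    · exact ⟨l.flatMap f, by simp⟩
    · rw [List.flatMap_cons, OccursAt, List.drop_append, hf, add_mul, one_mul, Nat.add_sub_cancel,
        List.drop_eq_nil_of_le (by simp [hf]), List.nil_append]
      exact ih (by simpa using hi)

theorem occursAt_flatMap_finRange {k m : ℕ} {f : Fin k → List ℕ} (hf : ∀ i, (f i).length = m)
    (i : Fin k) : OccursAt ((List.finRange k).flatMap f) (i * m) (f i) := by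
  simpa using occursAt_flatMap hf (List.finRange k) (i := i) (by simp)

end RAM

namespace SiblingInstance

open RAM

variable (I : SiblingInstance)

/-- The ranks that the student `a` gives to the outside option and to the classes. -/
def studentRow (a : Fin I.nA) : List ℕ :=
  (none :: (List.finRange I.nB).map some).map fun x => (I.studentRank a x : ℕ)

/-- The ranks that the class `b` gives to the outside option and to the students. -/
def classRow (b : Fin I.nB) : List ℕ :=
  (none :: (List.finRange I.nA).map some).map fun x => (I.schoolRank b x : ℕ)

/-- A row of the incidence matrix of the set of pairs of siblings. -/
def siblingRow (a : Fin I.nA) : List ℕ :=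
  (List.finRange I.nA).map fun a' => if (a, a') ∈ I.siblings then 1 else 0

/-- The instance as a sequence of numbers, in the same format as `MSSPInstance.encode`. -/
def encode : List ℕ :=
  [I.nA, I.nB, I.k]
    ++ (List.finRange I.nA).flatMap I.studentRow
    ++ (List.finRange I.nB).flatMap I.classRow
    ++ (List.finRange I.nB).map I.quota
    ++ (List.finRange I.nB).map (fun b => (I.activity b : ℕ))
    ++ (List.finRange I.nA).flatMap I.siblingRow

/-- The position of the ranks given by the student number `i`. -/
def studentPos (i : ℕ) : ℕ := 3 + i * (I.nB + 1)

/-- The position of the ranks given by the class number `i`. -/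
def classPos (i : ℕ) : ℕ := I.studentPos I.nA + i * (I.nA + 1)

/-- The position of the row number `i` of the incidence matrix of the set of pairs of siblings. -/
def siblingPos (i : ℕ) : ℕ := I.classPos I.nB + I.nB + I.nB + i * I.nA

variable {I}

theorem length_studentRow (a : Fin I.nA) : (I.studentRow a).length = I.nB + 1 := by
  simp [studentRow]

theorem length_classRow (b : Fin I.nB) : (I.classRow b).length = I.nA + 1 := by
  simp [classRow]

theorem length_siblingRow (a : Fin I.nA) : (I.siblingRow a).length = I.nA := by
  simp [siblingRow]

theorem length_encode : I.encode.length = I.siblingPos I.nA := by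
  simp +arith [encode, siblingPos, classPos, studentPos, List.length_flatMap, length_studentRow,
    length_classRow, length_siblingRow]

theorem occursAt_studentRow (a : Fin I.nA) :
    OccursAt I.encode (I.studentPos a) (I.studentRow a) :=
  (((((occursAt_append _ _).append _).append _).append _).append _).trans
    (occursAt_flatMap_finRange length_studentRow a)

theorem occursAt_classRow (b : Fin I.nB) : OccursAt I.encode (I.classPos b) (I.classRow b) := by
  have h : OccursAt I.encode _ _ := ((((occursAt_append _ _).append _).append _).append _).trans
    (occursAt_flatMap_finRange length_classRow b)
  convert h using 1
  simp +arith [classPos, studentPos, List.length_flatMap, length_studentRow]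

theorem occursAt_quotas :
    OccursAt I.encode (I.classPos I.nB) ((List.finRange I.nB).map I.quota) := by
  have h : OccursAt I.encode _ _ := (((occursAt_append _ _).append _).append _)
  convert h using 1
  simp +arith [classPos, studentPos, List.length_flatMap, length_studentRow, length_classRow]

theorem occursAt_activities :
    OccursAt I.encode (I.classPos I.nB + I.nB)
      ((List.finRange I.nB).map fun b => (I.activity b : ℕ)) := by
  have h : OccursAt I.encode _ _ := (occursAt_append _ _).append _
  convert h using 1
  simp +arith [classPos, studentPos, List.length_flatMap, length_studentRow, length_classRow]

theorem occursAt_siblingRow (a : Fin I.nA) :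
    OccursAt I.encode (I.siblingPos a) (I.siblingRow a) := by
  have h : OccursAt I.encode _ _ := (occursAt_append _ _).trans
    (occursAt_flatMap_finRange length_siblingRow a)
  convert h using 1
  simp +arith [siblingPos, classPos, studentPos, List.length_flatMap, length_studentRow,
    length_classRow]

theorem getD_encode_zero : I.encode.getD 0 0 = I.nA := rfl

theorem getD_encode_one : I.encode.getD 1 0 = I.nB := rfl

theorem getD_encode_student_none (a : Fin I.nA) :
    I.encode.getD (I.studentPos a) 0 = I.studentRank a none :=
  (occursAt_studentRow a).getD (i := 0) (by simp [studentRow])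

theorem getD_encode_student_some (a : Fin I.nA) (b : Fin I.nB) :
    I.encode.getD (I.studentPos a + (b + 1)) 0 = I.studentRank a (some b) := by
  rw [(occursAt_studentRow a).getD (by simp [studentRow])]
  simp [studentRow, List.getD_eq_getElem?_getD]

theorem getD_encode_class_none (b : Fin I.nB) :
    I.encode.getD (I.classPos b) 0 = I.schoolRank b none :=
  (occursAt_classRow b).getD (i := 0) (by simp [classRow])

theorem getD_encode_class_some (b : Fin I.nB) (a : Fin I.nA) :
    I.encode.getD (I.classPos b + (a + 1)) 0 = I.schoolRank b (some a) := by
  rw [(occursAt_classRow b).getD (by simp [classRow])]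
  simp [classRow, List.getD_eq_getElem?_getD]

theorem getD_encode_quota (b : Fin I.nB) : I.encode.getD (I.classPos I.nB + b) 0 = I.quota b := by
  rw [occursAt_quotas.getD (by simp)]
  simp [List.getD_eq_getElem?_getD]

theorem getD_encode_activity (b : Fin I.nB) :
    I.encode.getD (I.classPos I.nB + I.nB + b) 0 = I.activity b := by
  rw [occursAt_activities.getD (by simp)]
  simp [List.getD_eq_getElem?_getD]

theorem getD_encode_sibling (a a' : Fin I.nA) :
    I.encode.getD (I.siblingPos a + a') 0 = if (a, a') ∈ I.siblings then 1 else 0 := by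
  rw [(occursAt_siblingRow a).getD (by simp [siblingRow])]
  simp [siblingRow, List.getD_eq_getElem?_getD]

theorem nA_mul_nB_lt_length_encode : I.nA * I.nB < I.encode.length := by
  rw [length_encode, siblingPos, classPos, studentPos, mul_add]
  omega

theorem nA_le_length_encode : I.nA ≤ I.encode.length := by
  rw [length_encode, siblingPos, classPos, studentPos, mul_add]
  omega

theorem nB_le_length_encode : I.nB ≤ I.encode.length := by
  rw [length_encode, siblingPos]
  omega

end SiblingInstance

/-! ### The program -/

namespace MSSPProgram

open RAM SchoolInstance SiblingInstance

/-- The name of the array that holds the positions `studentPos`. -/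
abbrev studentPosArray : ℕ := 3

/-- The name of the array that holds the positions `classPos`. -/
abbrev classPosArray : ℕ := 4

/-- The name of the array that holds the positions `siblingPos`. -/
abbrev siblingPosArray : ℕ := 5

/-- The name of the array that holds the current matching, as the rank that each student gives to
her partner. -/
abbrev rankArray : ℕ := 6

/-- The variable of the loops over the positions of the input. -/
abbrev roundVar : ℕ := 7

/-- The variable of the loop over the students. -/
abbrev studentVar : ℕ := 8

/-- The variable that receives the truth values of formulas. -/
abbrev answerVar : ℕ := 9

/-- The store holds the instance `I`, the positions of its parts and the matching `M`. -/
structure Represents (I : SiblingInstance) (M : Fin I.nA → Option (Fin I.nB)) (s : Store) :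
    Prop where
  entry : ∀ i, s 0 i = I.encode.getD i 0
  length : s 1 0 = I.encode.length
  studentPos : ∀ a : Fin I.nA, s studentPosArray a = I.studentPos a
  classPos : ∀ i ≤ I.nB, s classPosArray i = I.classPos i
  siblingPos : ∀ a : Fin I.nA, s siblingPosArray a = I.siblingPos a
  rank : ∀ a : Fin I.nA, s rankArray a = I.studentRank a (M a)

/-- In the store `s`, where the arrays from `D` on are free, the variable `x` has the value `n`. -/
def Refers (s : Store) (D x n : ℕ) : Prop := x < D ∧ s x 0 = n

/-- The rank that the student `x` gives to her partner. -/
def partnerRank (x : ℕ) : Expr := .read rankArray (.var x)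

/-- The rank that the student `x` gives to the outside option. -/
def studentRankNone (x : ℕ) : Expr := .read 0 (.read studentPosArray (.var x))

/-- The rank that the student `x` gives to the class `y`. -/
def studentRankSome (x y : ℕ) : Expr :=
  .read 0 (.add (.read studentPosArray (.var x)) (.add (.var y) (.num 1)))

/-- The rank that the class `y` gives to the outside option. -/
def schoolRankNone (y : ℕ) : Expr := .read 0 (.read classPosArray (.var y))

/-- The rank that the class `y` gives to the student `x`. -/
def schoolRankSome (y x : ℕ) : Expr :=
  .read 0 (.add (.read classPosArray (.var y)) (.add (.var x) (.num 1)))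

/-- The quota of the class `y`. -/
def classQuota (y : ℕ) : Expr := .read 0 (.add (.read classPosArray (.entry 1)) (.var y))

/-- The activity of the class `y`. -/
def classActivity (y : ℕ) : Expr :=
  .read 0 (.add (.add (.read classPosArray (.entry 1)) (.entry 1)) (.var y))

/-- The entry of the incidence matrix of the siblings in row `x` and column `x'`. -/
def sibling (x x' : ℕ) : Expr := .read 0 (.add (.read siblingPosArray (.var x)) (.var x'))

variable {I : SiblingInstance} {M : Fin I.nA → Option (Fin I.nB)} {s s' : Store}
  {a a' : Fin I.nA} {b b' : Fin I.nB} {D x x' y y' : ℕ}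

theorem Refers.put {n : ℕ} (h : Refers s D x n) (i : ℕ) : Refers (s.put D 0 i) (D + 2) x n :=
  ⟨h.1.trans (by omega), by rw [s.put_of_ne h.1.ne, h.2]⟩

theorem Refers.put_self (s : Store) (D i : ℕ) : Refers (s.put D 0 i) (D + 2) D i :=
  ⟨by omega, by rw [s.put_apply_self, Function.update_self]⟩

namespace Represents

theorem congr (h : Represents I M s) (hs : Set.EqOn s s' (Set.Iio roundVar)) :
    Represents I M s' where
  entry i := by rw [← hs (by decide), h.entry]
  length := by rw [← hs (by decide), h.length]
  studentPos a := by rw [← hs (by decide), h.studentPos]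
  classPos i hi := by rw [← hs (by decide), h.classPos i hi]
  siblingPos a := by rw [← hs (by decide), h.siblingPos]
  rank a := by rw [← hs (by decide), h.rank]

theorem put (h : Represents I M s) (hD : roundVar ≤ D) (i n : ℕ) :
    Represents I M (s.put D i n) :=
  h.congr (s.eqOn_put hD i n)

theorem value_students (h : Represents I M s) : (Expr.entry 0).value s = I.nA :=
  (h.entry 0).trans getD_encode_zero

theorem value_classes (h : Represents I M s) : (Expr.entry 1).value s = I.nB :=
  (h.entry 1).trans getD_encode_one

theorem value_partnerRank (h : Represents I M s) (hx : Refers s D x a) :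
    (partnerRank x).value s = I.studentRank a (M a) := by
  simp only [partnerRank, Expr.var, Expr.value, hx.2, h.rank]

theorem value_studentRankNone (h : Represents I M s) (hx : Refers s D x a) :
    (studentRankNone x).value s = I.studentRank a none := by
  simp only [studentRankNone, Expr.var, Expr.value, hx.2, h.studentPos, h.entry,
    getD_encode_student_none]

theorem value_studentRankSome (h : Represents I M s) (hx : Refers s D x a) (hy : Refers s D y b) :
    (studentRankSome x y).value s = I.studentRank a (some b) := by
  simp only [studentRankSome, Expr.var, Expr.value, hx.2, hy.2, h.studentPos, h.entry,
    getD_encode_student_some]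

theorem value_schoolRankNone (h : Represents I M s) (hy : Refers s D y b) :
    (schoolRankNone y).value s = I.schoolRank b none := by
  simp only [schoolRankNone, Expr.var, Expr.value, hy.2, h.classPos b b.is_lt.le, h.entry,
    getD_encode_class_none]

theorem value_schoolRankSome (h : Represents I M s) (hy : Refers s D y b) (hx : Refers s D x a) :
    (schoolRankSome y x).value s = I.schoolRank b (some a) := by
  simp only [schoolRankSome, Expr.var, Expr.value, hx.2, hy.2, h.classPos b b.is_lt.le, h.entry,
    getD_encode_class_some]

theorem value_classQuota (h : Represents I M s) (hy : Refers s D y b) :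
    (classQuota y).value s = I.quota b := by
  simp only [classQuota, Expr.var, Expr.value, hy.2, h.value_classes,
    h.classPos _ le_rfl, h.entry, getD_encode_quota]

theorem value_classActivity (h : Represents I M s) (hy : Refers s D y b) :
    (classActivity y).value s = I.activity b := by
  simp only [classActivity, Expr.var, Expr.value, hy.2, h.value_classes,
    h.classPos _ le_rfl, h.entry, getD_encode_activity]

theorem value_sibling (h : Represents I M s) (hx : Refers s D x a) (hx' : Refers s D x' a') :
    (sibling x x').value s = if (a, a') ∈ I.siblings then 1 else 0 := by
  simp only [sibling, Expr.var, Expr.value, hx.2, hx'.2, h.siblingPos, h.entry,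
    getD_encode_sibling]

end Represents

/-- The student `x` is assigned to the class `y`. -/
def isAssigned (x y : ℕ) : Formula := .eq (partnerRank x) (studentRankSome x y)

/-- The student `x` is assigned to the outside option. -/
def isUnassigned (x : ℕ) : Formula := .eq (partnerRank x) (studentRankNone x)

/-- The student `x` prefers the class `y` to her partner. -/
def passed (x y : ℕ) : Formula := .lt (studentRankSome x y) (partnerRank x)

/-- The student `x` is eligible for the class `y`. -/
def eligible (x y : ℕ) : Formula := .lt (studentRankSome x y) (studentRankNone x)

/-- The class `y` prefers the student `x₁` to the student `x₂`. -/
def prefers (y x₁ x₂ : ℕ) : Formula := .lt (schoolRankSome y x₁) (schoolRankSome y x₂)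

/-- The class `y` prefers the student `x` to the outside option. -/
def acceptable (y x : ℕ) : Formula := .lt (schoolRankSome y x) (schoolRankNone y)

/-- The class `y` prefers the outside option to the student `x`. -/
def unacceptable (y x : ℕ) : Formula := .lt (schoolRankNone y) (schoolRankSome y x)

/-- The classes `y₁` and `y₂` belong to the same activity. -/
def sameActivity (y₁ y₂ : ℕ) : Formula := .eq (classActivity y₁) (classActivity y₂)

/-- The students `x₁` and `x₂` are siblings. -/
def sib (x₁ x₂ : ℕ) : Formula :=
  .disj (.lt (.num 0) (sibling x₁ x₂)) (.lt (.num 0) (sibling x₂ x₁))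

/-- The class `y` has no seat left for the student `x` besides those of better students. -/
def overbid (x y : ℕ) : Formula :=
  .atLeast (classQuota y) (.entry 0) fun x₁ => .conj (isAssigned x₁ y) (prefers y x₁ x)

/-- The class `y` has no free seat. -/
def full (y : ℕ) : Formula := .atLeast (classQuota y) (.entry 0) fun x => isAssigned x y

/-- The student `x` has passed all classes of the activity of `y` for which she is eligible. -/
def passedActivity (x y : ℕ) : Formula :=
  .all (.entry 1) fun y₁ => .imp (sameActivity y₁ y) (.imp (eligible x y₁) (passed x y₁))

/-- The formula for `SiblingInstance.Rejects`. -/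
def rejects (x y : ℕ) : Formula :=
  .disj (unacceptable y x) (.disj (overbid x y)
    (.disj (.ex (.entry 0) fun x₁ => .conj (passed x₁ y) (prefers y x₁ x))
      (.ex (.entry 0) fun x₁ => .conj (sib x x₁) (passedActivity x₁ y))))

/-- The formula for `SiblingInstance.IsRejected`. -/
def isRejected (x : ℕ) : Formula :=
  .ex (.entry 1) fun y => .conj (isAssigned x y) (rejects x y)

/-- The formula for `SiblingInstance.Succeeds`. -/
def succeeds : Formula :=
  .conj
    (.all (.entry 0) fun x => .all (.entry 1) fun y =>
      .imp (passed x y) (.imp (acceptable y x) (full y)))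
    (.all (.entry 0) fun x => .all (.entry 0) fun x₁ => .imp (sib x x₁) (.neg (isUnassigned x)))

namespace Represents

theorem holds_isAssigned (h : Represents I M s) (hx : Refers s D x a) (hy : Refers s D y b) :
    (isAssigned x y).Holds D s ↔ M a = some b := by
  rw [isAssigned, Formula.holds_eq, h.value_partnerRank hx, h.value_studentRankSome hx hy,
    Fin.val_inj, EmbeddingLike.apply_eq_iff_eq]

theorem holds_isUnassigned (h : Represents I M s) (hx : Refers s D x a) :
    (isUnassigned x).Holds D s ↔ M a = none := by
  rw [isUnassigned, Formula.holds_eq, h.value_partnerRank hx, h.value_studentRankNone hx,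
    Fin.val_inj, EmbeddingLike.apply_eq_iff_eq]

theorem holds_passed (h : Represents I M s) (hx : Refers s D x a) (hy : Refers s D y b) :
    (passed x y).Holds D s ↔ I.StudentPrefers a (some b) (M a) := by
  rw [passed, Formula.Holds, h.value_partnerRank hx, h.value_studentRankSome hx hy]
  rfl

theorem holds_eligible (h : Represents I M s) (hx : Refers s D x a) (hy : Refers s D y b) :
    (eligible x y).Holds D s ↔ I.Eligible a b := by
  rw [eligible, Formula.Holds, h.value_studentRankNone hx, h.value_studentRankSome hx hy]
  rfl

theorem holds_prefers (h : Represents I M s) (hy : Refers s D y b) (hx : Refers s D x a)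
    (hx' : Refers s D x' a') :
    (prefers y x x').Holds D s ↔ I.SchoolPrefers b (some a) (some a') := by
  rw [prefers, Formula.Holds, h.value_schoolRankSome hy hx, h.value_schoolRankSome hy hx']
  rfl

theorem holds_acceptable (h : Represents I M s) (hy : Refers s D y b) (hx : Refers s D x a) :
    (acceptable y x).Holds D s ↔ I.SchoolPrefers b (some a) none := by
  rw [acceptable, Formula.Holds, h.value_schoolRankSome hy hx, h.value_schoolRankNone hy]
  rfl

theorem holds_unacceptable (h : Represents I M s) (hy : Refers s D y b) (hx : Refers s D x a) :
    (unacceptable y x).Holds D s ↔ I.SchoolPrefers b none (some a) := by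
  rw [unacceptable, Formula.Holds, h.value_schoolRankSome hy hx, h.value_schoolRankNone hy]
  rfl

theorem holds_sameActivity (h : Represents I M s) (hy : Refers s D y b) (hy' : Refers s D y' b') :
    (sameActivity y y').Holds D s ↔ I.activity b = I.activity b' := by
  rw [sameActivity, Formula.holds_eq, h.value_classActivity hy, h.value_classActivity hy',
    Fin.val_inj]

theorem holds_sib (h : Represents I M s) (hx : Refers s D x a) (hx' : Refers s D x' a') :
    (sib x x').Holds D s ↔ I.Sib a a' := by
  refine Formula.holds_disj ?_ ?_
  · rw [Formula.Holds, h.value_sibling hx hx']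
    split_ifs <;> simpa [Expr.value]
  · rw [Formula.Holds, h.value_sibling hx' hx]
    split_ifs <;> simpa [Expr.value]

open Classical in
theorem holds_overbid (h : Represents I M s) (hD : roundVar ≤ D) (hx : Refers s D x a)
    (hy : Refers s D y b) : (overbid x y).Holds D s ↔
      I.quota b ≤
        ((I.assigned M b).filter fun a' => I.SchoolPrefers b (some a') (some a)).card := by
  refine (Formula.holds_atLeast _ h.value_students fun a' => Formula.holds_conj
    ((h.put hD 0 a').holds_isAssigned (.put_self s D a') (hy.put a'))
    ((h.put hD 0 a').holds_prefers (hy.put a') (.put_self s D a') (hx.put a'))).trans ?_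
  rw [h.value_classQuota hy, assigned, Finset.filter_filter]
  congr!

theorem holds_full (h : Represents I M s) (hD : roundVar ≤ D) (hy : Refers s D y b) :
    (full y).Holds D s ↔ I.quota b ≤ (I.assigned M b).card := by
  have hassigned (a : Fin I.nA) :
      (isAssigned D y).Holds (D + 2) (s.put D 0 a) ↔ M a = some b :=
    (h.put hD 0 a).holds_isAssigned (.put_self s D a) (hy.put a)
  rw [full, Formula.holds_atLeast _ h.value_students hassigned, h.value_classQuota hy, assigned]
  congr!

theorem holds_passedActivity (h : Represents I M s) (hD : roundVar ≤ D) (hx : Refers s D x a)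
    (hy : Refers s D y b) : (passedActivity x y).Holds D s ↔
      ∀ b', I.activity b' = I.activity b → I.Eligible a b' → I.StudentPrefers a (some b') (M a) :=
  Formula.holds_all h.value_classes fun b' =>
    have h' := h.put hD 0 b'
    have hy' := Refers.put_self s D b'
    Formula.holds_imp (h'.holds_sameActivity hy' (hy.put b'))
      (Formula.holds_imp (h'.holds_eligible (hx.put b') hy') (h'.holds_passed (hx.put b') hy'))

theorem holds_rejects (h : Represents I M s) (hD : roundVar ≤ D) (hx : Refers s D x a)
    (hy : Refers s D y b) : (rejects x y).Holds D s ↔ I.Rejects M a b := by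
  rw [rejects_iff]
  refine Formula.holds_disj (h.holds_unacceptable hy hx)
    (Formula.holds_disj (h.holds_overbid hD hx hy) (Formula.holds_disj ?_ ?_))
  · exact Formula.holds_ex h.value_students fun a' =>
      have h' := h.put hD 0 a'
      have hx' := Refers.put_self s D a'
      Formula.holds_conj (h'.holds_passed hx' (hy.put a'))
        (h'.holds_prefers (hy.put a') hx' (hx.put a'))
  · exact Formula.holds_ex h.value_students fun a' =>
      have h' := h.put hD 0 a'
      have hx' := Refers.put_self s D a'
      Formula.holds_conj (h'.holds_sib (hx.put a') hx')
        (h'.holds_passedActivity (hD.trans (Nat.le_add_right D 2)) hx' (hy.put a'))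

theorem holds_isRejected (h : Represents I M s) (hD : roundVar ≤ D) (hx : Refers s D x a) :
    (isRejected x).Holds D s ↔ I.IsRejected M a :=
  Formula.holds_ex h.value_classes fun b =>
    have h' := h.put hD 0 b
    have hy := Refers.put_self s D b
    Formula.holds_conj (h'.holds_isAssigned (hx.put b) hy)
      (h'.holds_rejects (hD.trans (Nat.le_add_right D 2)) (hx.put b) hy)

theorem holds_succeeds (h : Represents I M s) (hD : roundVar ≤ D) :
    succeeds.Holds D s ↔ I.Succeeds M := by
  have hD' : roundVar ≤ D + 2 := hD.trans (Nat.le_add_right D 2)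
  refine (Formula.holds_conj ?_ ?_).trans ⟨fun h => ⟨h.1, h.2⟩, fun h => ⟨h.1, h.2⟩⟩
  · refine Formula.holds_all h.value_students fun a => ?_
    have h₁ := h.put hD 0 a
    refine Formula.holds_all h₁.value_classes fun b => ?_
    have h₂ := h₁.put hD' 0 b
    have hx := (Refers.put_self s D a).put b
    have hy := Refers.put_self (s.put D 0 a) (D + 2) b
    exact Formula.holds_imp (h₂.holds_passed hx hy) (Formula.holds_imp (h₂.holds_acceptable hy hx)
      (h₂.holds_full (hD'.trans (Nat.le_add_right _ 2)) hy))
  · refine Formula.holds_all h.value_students fun a => ?_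
    have h₁ := h.put hD 0 a
    refine Formula.holds_all h₁.value_students fun a' => ?_
    have h₂ := h₁.put hD' 0 a'
    have hx := (Refers.put_self s D a).put a'
    have hx' := Refers.put_self (s.put D 0 a) (D + 2) a'
    exact Formula.holds_imp (h₂.holds_sib hx hx') (not_congr (h₂.holds_isUnassigned hx))

end Represents

theorem decides_isRejected : ((isRejected studentVar).compile answerVar).Decides answerVar
    ((isRejected studentVar).Holds answerVar) := by
  refine Formula.decides_compile (A := Set.Iio answerVar) (by decide) le_rfl ?_
  simp [isRejected, rejects, passedActivity, overbid, sib, sameActivity, unacceptable, prefers,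
    eligible, passed, isAssigned, sibling, classActivity, classQuota, schoolRankSome,
    schoolRankNone, studentRankSome, studentRankNone, partnerRank, Formula.ex, Formula.all,
    Formula.imp, Formula.disj, Formula.eq, Formula.ReadsIn, Expr.ReadsIn, Expr.var,
    Expr.readsIn_entry, Expr.IsLoopBound.entry_zero, Expr.IsLoopBound.entry_one, studentPosArray,
    classPosArray, siblingPosArray, rankArray, studentVar, answerVar]

theorem decides_succeeds :
    (succeeds.compile answerVar).Decides answerVar (succeeds.Holds answerVar) := by
  refine Formula.decides_compile (A := Set.Iio answerVar) (by decide) le_rfl ?_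
  simp [succeeds, full, sib, acceptable, passed, isAssigned, isUnassigned, sibling, classQuota,
    schoolRankSome, schoolRankNone, studentRankSome, studentRankNone, partnerRank, Formula.all,
    Formula.ex, Formula.imp, Formula.disj, Formula.eq, Formula.ReadsIn, Expr.ReadsIn, Expr.var,
    Expr.readsIn_entry, Expr.IsLoopBound.entry_zero, Expr.IsLoopBound.entry_one, studentPosArray,
    classPosArray, siblingPosArray, rankArray, answerVar]

/-- Writes the numbers `e₀, e₀ + e, e₀ + 2 e, …` into the array `x`. -/
def fill (x : ℕ) (e₀ e : Expr) : Program :=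
  .seq (.write x (.num 0) e₀)
    (.forLoop roundVar .inputLength
      (.write x (.add (.var roundVar) (.num 1)) (.add (.read x (.var roundVar)) e)))

theorem implements_fill {x : ℕ} (hx : 2 ≤ x) (hne : x ≠ roundVar) (e₀ : Expr) {e : Expr}
    (he : ∀ s s' : Store, s 0 = s' 0 → e.value s = e.value s') :
    (fill x e₀ e).Implements fun s s' =>
      (∀ y, y ≠ x → y ≠ roundVar → s' y = s y) ∧
        ∀ i ≤ s 1 0, s' x i = e₀.value s + i * e.value s := by
  have hloop := Program.Implements.forLoop (v := roundVar)
    (Inv := fun s j s₁ => (∀ y, y ≠ x → y ≠ roundVar → s₁ y = s y) ∧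
      ∀ i ≤ j, s₁ x i = s x 0 + i * e.value s)
    (.write hx (.add (.var roundVar) (.num 1)) (.add (.read x (.var roundVar)) e))
    .inputLength (by decide) ?_ ?_ ?_
  · refine ((Program.Implements.write hx (.num 0) e₀).seq hloop).mono ?_
    rintro (s : Store) s' ⟨_, rfl, hother, htable⟩
    have h0 : s.put x 0 (e₀.value s) 0 = s 0 := s.put_of_ne (by omega) ..
    have h1 : s.put x 0 (e₀.value s) 1 = s 1 := s.put_of_ne (by omega) ..
    refine ⟨fun y hyx hyv => (hother y hyx hyv).trans (s.put_of_ne hyx ..), fun i hi => ?_⟩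
    simp only [Expr.inputLength, Expr.value, h1, he _ s h0, Store.put_apply_self,
      Function.update_self] at htable
    exact htable i hi
  · rintro (s : Store) _ rfl
    rw [s.put_of_ne hne.symm]
  · refine fun s => ⟨fun y _ hy => s.put_of_ne hy 0 0, fun i hi => ?_⟩
    obtain rfl := Nat.le_zero.1 hi
    rw [s.put_of_ne hne, zero_mul, add_zero]
  · rintro s j s₁ _ - hj ⟨hother, htable⟩ rfl
    refine ⟨fun y hyx hyv => ?_, fun i hi => ?_⟩
    · rw [Store.put_of_ne _ hyv, Store.put_of_ne _ hyx, hother y hyx hyv]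
    · rw [Store.put_of_ne _ hne, Store.put_apply_self]
      simp only [Expr.value, Expr.var, hj, Function.update_apply]
      split_ifs with hij
      · rw [htable j le_rfl, he s₁ s (hother 0 (by omega) (by decide)), hij]
        ring
      · exact htable i (by omega)

/-- Computes the tables of positions. The array `rankArray` is not touched: on the initial store
it is `0`, which stands for the assignment of the students to their favourites. -/
def computePositions : Program :=
  .seq (fill studentPosArray (.num 3) (.add (.entry 1) (.num 1)))
    (.seq (fill classPosArray (.read studentPosArray (.entry 0)) (.add (.entry 0) (.num 1)))
      (fill siblingPosArray
        (.add (.add (.read classPosArray (.entry 1)) (.entry 1)) (.entry 1)) (.entry 0)))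

theorem implements_computePositions : computePositions.Implements fun s s' =>
    ∀ I : SiblingInstance, s = input I.encode → Represents I I.favourites s' := by
  refine ((implements_fill (by decide) (by decide) _ fun s s' h => ?_).seq
    ((implements_fill (by decide) (by decide) _ fun s s' h => ?_).seq
      (implements_fill (by decide) (by decide) _ fun s s' h => ?_))).mono ?_
  · simp only [Expr.value, Expr.entry, h]
  · simp only [Expr.value, Expr.entry, h]
  · simp only [Expr.value, Expr.entry, h]
  rintro (s : Store) s' ⟨s₁, ⟨hs₁, htable₁⟩, s₂, ⟨hs₂, htable₂⟩, hs₃, htable₃⟩ I rfl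
  have hentry (i : ℕ) : input I.encode 0 i = I.encode.getD i 0 := by simp [input]
  have hlength : input I.encode 1 0 = I.encode.length := by simp [input]
  have hnA : input I.encode 0 0 = I.nA := (hentry 0).trans getD_encode_zero
  have hnB : input I.encode 0 1 = I.nB := (hentry 1).trans getD_encode_one
  simp only [Expr.value, Expr.entry, hs₂ 0 (by decide) (by decide), hs₂ 1 (by decide) (by decide),
    hs₁ 0 (by decide) (by decide), hs₁ 1 (by decide) (by decide), hnA, hnB, hlength]
    at htable₁ htable₂ htable₃
  have hclass (i : ℕ) (hi : i ≤ I.encode.length) : s₂ classPosArray i = I.classPos i := by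
    rw [htable₂ i hi, htable₁ _ nA_le_length_encode, classPos, SiblingInstance.studentPos]
  refine ⟨fun i => ?_, ?_, fun a => ?_, fun i hi => ?_, fun a => ?_, fun a => ?_⟩
  · rw [hs₃ _ (by decide) (by decide), hs₂ _ (by decide) (by decide),
      hs₁ _ (by decide) (by decide), hentry]
  · rw [hs₃ _ (by decide) (by decide), hs₂ _ (by decide) (by decide),
      hs₁ _ (by decide) (by decide), hlength]
  · rw [hs₃ _ (by decide) (by decide), hs₂ _ (by decide) (by decide),
      htable₁ _ (a.is_lt.le.trans nA_le_length_encode), SiblingInstance.studentPos]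
  · rw [hs₃ _ (by decide) (by decide), hclass i (hi.trans nB_le_length_encode)]
  · rw [htable₃ _ (a.is_lt.le.trans nA_le_length_encode), hclass _ nB_le_length_encode,
      SiblingInstance.siblingPos]
  · rw [hs₃ _ (by decide) (by decide), hs₂ _ (by decide) (by decide),
      hs₁ _ (by decide) (by decide), favourites, Equiv.apply_symm_apply]
    simp [input]

/-- The program for `SiblingInstance.advance`. -/
def advanceStudent : Program :=
  .seq ((isRejected studentVar).compile answerVar)
    (.cond (.var answerVar)
      (.write rankArray (.var studentVar) (.add (partnerRank studentVar) (.num 1))) .skip)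

theorem Represents.advance_of_isRejected (h : Represents I M s) (hM : Acceptable M)
    (ha : I.IsRejected M a) :
    Represents I (I.advance M a) (s.put rankArray a (I.studentRank a (M a) + 1)) where
  entry i := by rw [s.put_of_ne (by decide), h.entry]
  length := by rw [s.put_of_ne (by decide), h.length]
  studentPos a := by rw [s.put_of_ne (by decide), h.studentPos]
  classPos i hi := by rw [s.put_of_ne (by decide), h.classPos i hi]
  siblingPos a := by rw [s.put_of_ne (by decide), h.siblingPos]
  rank a' := by
    rw [s.put_apply_self]
    by_cases ha' : a' = a
    · rw [ha', Function.update_self, ha.rank_advance hM]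
    · rw [Function.update_of_ne (Fin.val_ne_of_ne ha'), h.rank, advance_of_ne ha']

theorem implements_advanceStudent : advanceStudent.Implements fun s s' =>
    (s' roundVar = s roundVar ∧ s' studentVar = s studentVar) ∧
      ∀ (I : SiblingInstance) (M : Fin I.nA → Option (Fin I.nB)) (a : Fin I.nA),
        Acceptable M → Represents I M s → s studentVar 0 = a → Represents I (I.advance M a) s' := by
  refine (decides_isRejected.seq (.cond (.var answerVar)
    (.write (by decide) (.var studentVar) (.add (partnerRank studentVar) (.num 1))) .skip)).mono ?_
  rintro (s : Store) s' ⟨s₁, ⟨hs, hans⟩, hmove, hstay⟩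
  have hkeep {x : ℕ} (hx : x < answerVar) : s₁ x = s x := (hs.apply_eq hx).symm
  have hvar : (Expr.var answerVar).value s₁ ≠ 0 ↔ (isRejected studentVar).Holds answerVar s := by
    simp [Expr.value, Expr.var, hans]
  by_cases hrej : (isRejected studentVar).Holds answerVar s
  · obtain rfl := hmove (hvar.2 hrej)
    refine ⟨⟨?_, ?_⟩, fun I M a hM h ha => ?_⟩
    · rw [s₁.put_of_ne (by decide), hkeep (by decide)]
    · rw [s₁.put_of_ne (by decide), hkeep (by decide)]
    · have h₁ : Represents I M s₁ := h.congr fun x hx => (hkeep (lt_trans hx (by decide))).symm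
      have ha₁ : Refers s₁ answerVar studentVar a := ⟨by decide, by rw [hkeep (by decide), ha]⟩
      rw [Expr.value, h₁.value_partnerRank ha₁, Expr.var, Expr.value, Expr.value, Expr.value,
        ha₁.2]
      exact h₁.advance_of_isRejected hM ((h.holds_isRejected (by decide) ⟨by decide, ha⟩).1 hrej)
  · obtain rfl := hstay (not_not.1 (mt hvar.1 hrej))
    refine ⟨⟨hkeep (by decide), hkeep (by decide)⟩, fun I M a _ h ha => ?_⟩
    rw [advance_of_not_isRejected
      (mt (h.holds_isRejected (by decide) ⟨by decide, ha⟩).2 hrej)]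
    exact h.congr fun x hx => (hkeep (lt_trans hx (by decide))).symm

/-- The program for `SiblingInstance.sweep`. -/
def sweepStudents : Program := .forLoop studentVar (.entry 0) advanceStudent

theorem implements_sweepStudents : sweepStudents.Implements fun s s' =>
    s' roundVar = s roundVar ∧ ∀ (I : SiblingInstance) (M : Fin I.nA → Option (Fin I.nB)),
      Acceptable M → Represents I M s → Represents I (I.sweep M) s' := by
  refine (Program.Implements.forLoop (v := studentVar)
    (Inv := fun s i s₁ => s₁ roundVar = s roundVar ∧
      ∀ (I : SiblingInstance) (M : Fin I.nA → Option (Fin I.nB)), Acceptable M →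
        Represents I M s → Represents I (((List.finRange I.nA).take i).foldl I.advance M) s₁)
    implements_advanceStudent .entry_zero (by decide) ?_ ?_ ?_).mono ?_
  · exact fun s s' h => congrFun h.1.2 0
  · exact fun s => ⟨s.put_of_ne (by decide) 0 0, fun I M _ h => h.put (by decide) 0 0⟩
  · rintro s i s₁ s₂ hi hvar ⟨hround, h₁⟩ ⟨⟨hround', -⟩, h₂⟩
    refine ⟨by rw [s₂.put_of_ne (by decide), hround', hround], fun I M hM h => ?_⟩
    rw [h.value_students] at hi
    rw [List.take_add_one, List.getElem?_eq_getElem (by simpa using hi), Option.toList_some,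
      List.foldl_append, List.foldl_cons, List.foldl_nil, List.getElem_finRange]
    exact (h₂ I _ _ (rejectionProof_none.dominates_foldl_advance hM _) (h₁ I M hM h) hvar).put
      (by decide) 0 _
  · rintro s s' ⟨hround, h⟩
    refine ⟨hround, fun I M hM hs => ?_⟩
    have hs' := h I M hM hs
    rwa [hs.value_students, List.take_of_length_le (by simp)] at hs'

/-- Sweeps as often as the input has entries, which is more often than students can move. -/
def sweepRepeatedly : Program := .forLoop roundVar .inputLength sweepStudents

theorem implements_sweepRepeatedly : sweepRepeatedly.Implements fun s s' =>
    ∀ I : SiblingInstance, Represents I I.favourites s →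
      Represents I (I.sweep^[I.encode.length] I.favourites) s' := by
  refine (Program.Implements.forLoop (v := roundVar)
    (Inv := fun s i s₁ => ∀ I : SiblingInstance, Represents I I.favourites s →
      Represents I (I.sweep^[i] I.favourites) s₁)
    implements_sweepStudents .inputLength (by decide) ?_ ?_ ?_).mono ?_
  · exact fun s s' h => congrFun h.1 0
  · exact fun s I h => h.put le_rfl 0 0
  · rintro s i s₁ s₂ - - h₁ ⟨-, h₂⟩ I h
    rw [Function.iterate_succ_apply']
    exact (h₂ I _ (acceptable_iterate_sweep i) (h₁ I h)).put le_rfl 0 _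
  · intro s s' h I hs
    have hs' := h I hs
    rwa [Expr.inputLength, Expr.value, Expr.value, hs.length] at hs'

/-- Decides whether there is an activity-stable matching. -/
def decideActivityStable : Program :=
  .seq computePositions (.seq sweepRepeatedly
    (.seq (succeeds.compile answerVar) (.write 2 (.num 0) (.var answerVar))))

theorem implements_decideActivityStable : decideActivityStable.Implements fun s s' =>
    ∀ I : SiblingInstance, s = input I.encode →
      ((∃ M, I.IsActivityStable M) → output s' = 1) ∧
        ((¬ ∃ M, I.IsActivityStable M) → output s' = 0) := by
  refine (implements_computePositions.seq (implements_sweepRepeatedly.seq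
    (decides_succeeds.seq (.write le_rfl (.num 0) (.var answerVar))))).mono ?_
  rintro s _ ⟨s₁, hpos, s₂, hsweep, s₃, ⟨-, hans⟩, rfl⟩ I hs
  have h₂ := hsweep I (hpos I hs)
  rw [exists_isActivityStable_iff nA_mul_nB_lt_length_encode,
    ← h₂.holds_succeeds (D := answerVar) (by decide)]
  simp only [output, Store.put_apply_self, Expr.value, Expr.var, Function.update_self, hans]
  exact ⟨fun h => if_pos h, fun h => if_neg h⟩

end MSSPProgram

theorem mainTheorem5_general :
    RAM.SolvableInPolyTime SiblingInstance.encode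
      (fun I : SiblingInstance => ∃ M : Fin I.nA → Option (Fin I.nB), I.IsActivityStable M) :=
  RAM.solvableInPolyTime_of_implements (fun _ => SiblingInstance.nA_le_length_encode)
    (fun _ => SiblingInstance.nB_le_length_encode) MSSPProgram.implements_decideActivityStable

/-- An instance of (MSSP), regardless of how many classes of an activity a student is eligible
for. -/
def MSSPInstance.toSiblingInstance (I : MSSPInstance) : SiblingInstance := { I with }

/-- It can be decided in polynomial time whether an instance of (MSSP) has an activity-stable
matching. -/
theorem mainTheorem5 :
    RAM.SolvableInPolyTime MSSPInstance.encode
      (fun I : MSSPInstance => ∃ M : Fin I.nA → Option (Fin I.nB), I.IsActivityStable M) := by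
  obtain ⟨c, p, h⟩ := mainTheorem5_general
  exact ⟨c, p, fun I => h I.toSiblingInstance⟩
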